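/- Let a tile be a triangle in the Euclidean plane with side lengths $1,2,\sqrt5$ (any position, rotation or reflection). The pinwheel substitution inflates a tile by the factor $\sqrt5$ and cuts the resulting triangle into five tiles as follows. If the inflated triangle has its right angle at $R$, the other end of its short leg at $S$ and the other end of its long leg at $L$, let $H_1=\frac{4S+L}{5}$, $H_2=\frac{2S+3L}{5}$, $M=\frac{R+L}{2}$, $F=\frac{R+H_1}{2}$; the five tiles are the triangles $H_1SR$, $FRM$, $FH_1M$, $H_2MH_1$, $H_2ML$. Iterating $n$ times (that is, applying this subdivision $n$ times to a triangle with side lengths $\sqrt5^{\,n},2\sqrt5^{\,n},\sqrt5\cdot\sqrt5^{\,n}$) gives the supertiles of level $n$. A pinwheel tiling is a tiling $T$ of the plane by tiles such that every finite set of tiles of $T$ is contained in some supertile. View a pinwheel tiling $T$ as a planar graph: its vertices are all corners of tiles of $T$, and two distinct vertices are adjacent if they lie on a common side of a tile of $T$ and no other vertex lies strictly between them on that side. Theorem. The graph of every pinwheel tiling has chromatic number $3$. -/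

import Mathlib

/-- A triangle in the Euclidean plane `ℂ`, given by its three labelled corners. For the right
triangles used here, `r` is the corner at the right angle, `s` the other end of the short leg and
`l` the other end of the long leg. -/
@[ext]
structure PinTriangle where
  r : ℂ
  s : ℂ
  l : ℂ

namespace PinTriangle

/-- The (closed, filled) triangle as a subset of the plane. -/
def carrier (t : PinTriangle) : Set ℂ := convexHull ℝ {t.r, t.s, t.l}

/-- The set of the three corners. -/
def corners (t : PinTriangle) : Set ℂ := {t.r, t.s, t.l}

/-- The set of the three closed sides. -/
def sides (t : PinTriangle) : Set (Set ℂ) :=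
  {segment ℝ t.r t.s, segment ℝ t.r t.l, segment ℝ t.s t.l}

/-- `t` has side lengths `c`, `2 c` and `√5 c`, hence a right angle at `t.r`. For `c = 1` these are
exactly the congruent copies (reflections included) of the pinwheel prototile. -/
def HasSize (t : PinTriangle) (c : ℝ) : Prop :=
  dist t.r t.s = c ∧ dist t.r t.l = 2 * c ∧ dist t.s t.l = √5 * c

/-- The point of the hypotenuse at distance one fifth of its length from `t.s`. -/
noncomputable def h₁ (t : PinTriangle) : ℂ := (4 * t.s + t.l) / 5

/-- The point of the hypotenuse at distance three fifths of its length from `t.s`. -/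
noncomputable def h₂ (t : PinTriangle) : ℂ := (2 * t.s + 3 * t.l) / 5

/-- The midpoint of the long leg. -/
noncomputable def m (t : PinTriangle) : ℂ := (t.r + t.l) / 2

/-- The midpoint of the segment from the right angle to `t.h₁`. -/
noncomputable def f (t : PinTriangle) : ℂ := (t.r + t.h₁) / 2

/-- The pinwheel subdivision: a triangle with side lengths `c, 2c, √5 c` is cut into five triangles
similar to it, with ratio `1/√5`. -/
def subdivide (t : PinTriangle) : Set PinTriangle :=
  {⟨t.h₁, t.s, t.r⟩, ⟨t.f, t.r, t.m⟩, ⟨t.f, t.h₁, t.m⟩, ⟨t.h₂, t.m, t.h₁⟩, ⟨t.h₂, t.m, t.l⟩}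

/-- The `n`-fold iterate of the subdivision, applied to `t`. -/
def iterSubdivide : ℕ → PinTriangle → Set PinTriangle
  | 0, t => {t}
  | n + 1, t => ⋃ t' ∈ t.subdivide, iterSubdivide n t'

end PinTriangle

/-- `P` is a supertile of level `n`: a prototile is inflated by `√5 ^ n`, moved by an isometry of the
plane, and subdivided `n` times, so that it ends up as a patch of `5 ^ n` copies of the prototile. -/
def IsPinwheelSupertile (n : ℕ) (P : Set PinTriangle) : Prop :=
  ∃ t : PinTriangle, t.HasSize (√5 ^ n) ∧ P = t.iterSubdivide n

/-- A pinwheel tiling: a tiling of the plane by copies of the prototile each of whose finite patches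
occurs in some supertile. -/
structure IsPinwheelTiling (T : Set PinTriangle) : Prop where
  hasSize : ∀ t ∈ T, t.HasSize 1
  covers : ⋃ t ∈ T, t.carrier = Set.univ
  disjoint_interior : ∀ t ∈ T, ∀ t' ∈ T, t ≠ t' →
    Disjoint (interior t.carrier) (interior t'.carrier)
  patches : ∀ F ⊆ T, F.Finite → ∃ n P, IsPinwheelSupertile n P ∧ F ⊆ P

/-- The vertices of the tiling: all corners of its tiles. -/
def tilingVertices (T : Set PinTriangle) : Set ℂ := ⋃ t ∈ T, t.corners

/-- The graph drawn by the tiling. The tiles need not meet side to side, so a side of one tile may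
contain corners of others in its interior and is cut into several edges there: two vertices are
adjacent iff they lie on a common side of a tile and no vertex lies strictly between them. -/
def tilingGraph (T : Set PinTriangle) : SimpleGraph (tilingVertices T) where
  Adj v w := v ≠ w ∧ (∃ t ∈ T, ∃ σ ∈ t.sides, (v : ℂ) ∈ σ ∧ (w : ℂ) ∈ σ) ∧
    Disjoint (openSegment ℝ (v : ℂ) (w : ℂ)) (tilingVertices T)
  symm := ⟨by
    rintro v w ⟨h, ⟨t, ht, σ, hσ, hv, hw⟩, hd⟩
    exact ⟨h.symm, ⟨t, ht, σ, hσ, hw, hv⟩, by rwa [openSegment_symm]⟩⟩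
  loopless := ⟨fun _ h => h.1 rfl⟩

-- The remaining facts show that pinwheel tilings exist.
namespace PinTriangle

theorem hasSize_iff {t : PinTriangle} {c : ℝ} (hc : 0 ≤ c) : t.HasSize c ↔
    (t.r.re - t.s.re) ^ 2 + (t.r.im - t.s.im) ^ 2 = c ^ 2 ∧
    (t.r.re - t.l.re) ^ 2 + (t.r.im - t.l.im) ^ 2 = 4 * c ^ 2 ∧
    (t.s.re - t.l.re) ^ 2 + (t.s.im - t.l.im) ^ 2 = 5 * c ^ 2 := by
  have h5 : (0 : ℝ) ≤ √5 := Real.sqrt_nonneg 5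
  have e5 : √5 ^ 2 = (5 : ℝ) := Real.sq_sqrt (by norm_num)
  unfold HasSize
  rw [Complex.dist_eq_re_im, Complex.dist_eq_re_im, Complex.dist_eq_re_im,
    Real.sqrt_eq_iff_eq_sq (by positivity) hc, Real.sqrt_eq_iff_eq_sq (by positivity) (by positivity),
    Real.sqrt_eq_iff_eq_sq (by positivity) (by positivity), mul_pow, mul_pow, e5]
  norm_num

theorem hasSize_of_mem_subdivide {t t' : PinTriangle} {c : ℝ} (hc : 0 ≤ c)
    (ht : t.HasSize (√5 * c)) (h : t' ∈ t.subdivide) : t'.HasSize c := by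
  have e5 : √5 ^ 2 = (5 : ℝ) := Real.sq_sqrt (by norm_num)
  rw [hasSize_iff (by positivity), mul_pow, e5] at ht
  obtain ⟨h1, h2, h3⟩ := ht
  rw [hasSize_iff hc]
  simp only [subdivide, Set.mem_insert_iff, Set.mem_singleton_iff] at h
  rcases h with rfl | rfl | rfl | rfl | rfl <;>
    simp [h₁, h₂, m, f] <;> ring_nf at h1 h2 h3 ⊢ <;> refine ⟨?_, ?_, ?_⟩ <;> linarith

theorem disjoint_of_separated {A B : PinTriangle} (a b d : ℝ) (hab : 0 < a ^ 2 + b ^ 2)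
    (hA : ∀ p ∈ A.corners, a * p.re + b * p.im ≤ d)
    (hB : ∀ p ∈ B.corners, d ≤ a * p.re + b * p.im) :
    Disjoint (interior A.carrier) (interior B.carrier) := by
  have lin : IsLinearMap ℝ fun p : ℂ => a * p.re + b * p.im :=
    ⟨fun x y => by simp; ring, fun c x => by simp; ring⟩
  have cA : A.carrier ⊆ {p | a * p.re + b * p.im ≤ d} :=
    convexHull_min hA (convex_halfSpace_le lin d)
  have cB : B.carrier ⊆ {p | d ≤ a * p.re + b * p.im} :=
    convexHull_min hB (convex_halfSpace_ge lin d)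
  rw [Set.disjoint_left]
  intro z zA zB
  have tend : Filter.Tendsto (fun e : ℝ => z + e * (⟨a, b⟩ : ℂ)) (nhds 0) (nhds z) := by
    have : Continuous (fun e : ℝ => z + e * (⟨a, b⟩ : ℂ)) := by fun_prop
    simpa using this.tendsto 0
  have ev := tend.eventually (mem_interior_iff_mem_nhds.1 zA)
  obtain ⟨e, he, hpos⟩ := ((ev.filter_mono nhdsWithin_le_nhds).and
    (self_mem_nhdsWithin : Set.Ioi (0 : ℝ) ∈ nhdsWithin 0 (Set.Ioi 0))).exists
  have i1 := cA he
  have i2 := cB (interior_subset zB)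
  simp at i1 i2 hpos
  nlinarith [mul_pos hpos hab]

theorem disjoint_of_mem_subdivide {t A B : PinTriangle} {c : ℝ} (hc : 0 < c) (ht : t.HasSize c)
    (hA : A ∈ t.subdivide) (hB : B ∈ t.subdivide) (hAB : A ≠ B) :
    Disjoint (interior A.carrier) (interior B.carrier) := by
  rw [hasSize_iff hc.le] at ht
  obtain ⟨q1, q2, q3⟩ := ht
  have hc2 : 0 < c ^ 2 := by positivity
  -- the separating line is given by `α, β, d` in the coordinates along the two legs
  have key : ∀ (A B : PinTriangle) (α β d : ℝ), 0 < α ^ 2 + β ^ 2 →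
      (∀ p ∈ A.corners, (α * (t.s.re - t.r.re) + β * (t.l.re - t.r.re)) * (p.re - t.r.re) +
        (α * (t.s.im - t.r.im) + β * (t.l.im - t.r.im)) * (p.im - t.r.im) ≤ d * c ^ 2) →
      (∀ p ∈ B.corners, d * c ^ 2 ≤ (α * (t.s.re - t.r.re) + β * (t.l.re - t.r.re)) *
        (p.re - t.r.re) + (α * (t.s.im - t.r.im) + β * (t.l.im - t.r.im)) * (p.im - t.r.im)) →
      Disjoint (interior A.carrier) (interior B.carrier) := by
    intro A B α β d hαβ h1 h2
    refine disjoint_of_separated (α * (t.s.re - t.r.re) + β * (t.l.re - t.r.re))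
      (α * (t.s.im - t.r.im) + β * (t.l.im - t.r.im))
      (d * c ^ 2 + ((α * (t.s.re - t.r.re) + β * (t.l.re - t.r.re)) * t.r.re +
      (α * (t.s.im - t.r.im) + β * (t.l.im - t.r.im)) * t.r.im)) ?_
      (fun p hp => by linarith [h1 p hp]) (fun p hp => by linarith [h2 p hp])
    have : (α * (t.s.re - t.r.re) + β * (t.l.re - t.r.re)) ^ 2 +
        (α * (t.s.im - t.r.im) + β * (t.l.im - t.r.im)) ^ 2 = (α ^ 2 + 4 * β ^ 2) * c ^ 2 := by
      linear_combination (α ^ 2 + α * β) * q1 + (β ^ 2 + α * β) * q2 - α * β * q3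
    rw [this]
    have : 0 < α ^ 2 + 4 * β ^ 2 := by nlinarith [sq_nonneg β]
    positivity
  ring_nf at q1 q2 q3
  have s1 : ∀ B : PinTriangle, B = ⟨t.f, t.r, t.m⟩ ∨ B = ⟨t.f, t.h₁, t.m⟩ ∨ B = ⟨t.h₂, t.m, t.h₁⟩ ∨
      B = ⟨t.h₂, t.m, t.l⟩ →
      Disjoint (interior B.carrier) (interior (carrier ⟨t.h₁, t.s, t.r⟩)) := by
    rintro B (rfl | rfl | rfl | rfl) <;>
    · apply key _ _ 1 (-1) 0 (by norm_num) <;> simp [corners, h₁, h₂, m, f] <;> ring_nf <;>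
        try constructorm* _ ∧ _
      all_goals linarith
  have s2 : ∀ B : PinTriangle, B = ⟨t.f, t.h₁, t.m⟩ ∨ B = ⟨t.h₂, t.m, t.h₁⟩ ∨
      B = ⟨t.h₂, t.m, t.l⟩ →
      Disjoint (interior (carrier ⟨t.f, t.r, t.m⟩)) (interior B.carrier) := by
    rintro B (rfl | rfl | rfl) <;>
    · apply key _ _ 4 1 2 (by norm_num) <;> simp [corners, h₁, h₂, m, f] <;> ring_nf <;>
        try constructorm* _ ∧ _
      all_goals linarith
  have s3 : ∀ B : PinTriangle, B = ⟨t.h₂, t.m, t.h₁⟩ ∨ B = ⟨t.h₂, t.m, t.l⟩ →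
      Disjoint (interior (carrier ⟨t.f, t.h₁, t.m⟩)) (interior B.carrier) := by
    rintro B (rfl | rfl) <;>
    · apply key _ _ 3 2 4 (by norm_num) <;> simp [corners, h₁, h₂, m, f] <;> ring_nf <;>
        try constructorm* _ ∧ _
      all_goals linarith
  have s4 : Disjoint (interior (carrier ⟨t.h₂, t.m, t.h₁⟩)) (interior (carrier ⟨t.h₂, t.m, t.l⟩)) := by
    apply key _ _ (-1) 1 2 (by norm_num) <;> simp [corners, h₁, h₂, m] <;> ring_nf <;>
      refine ⟨?_, ?_, ?_⟩ <;> linarith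
  simp only [subdivide, Set.mem_insert_iff, Set.mem_singleton_iff] at hA hB
  rcases hA with rfl | hA
  · rcases hB with rfl | hB
    · exact absurd rfl hAB
    · exact (s1 _ hB).symm
  rcases hB with rfl | hB
  · exact s1 _ hA
  rcases hA with rfl | hA
  · rcases hB with rfl | hB
    · exact absurd rfl hAB
    · exact s2 _ hB
  rcases hB with rfl | hB
  · exact (s2 _ hA).symm
  rcases hA with rfl | hA
  · rcases hB with rfl | hB
    · exact absurd rfl hAB
    · exact s3 _ hB
  rcases hB with rfl | hB
  · exact (s3 _ hA).symm
  rcases hA with rfl | rfl <;> rcases hB with rfl | rfl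
  · exact absurd rfl hAB
  · exact s4
  · exact s4.symm
  · exact absurd rfl hAB

theorem mem_carrier_iff {t : PinTriangle} {z : ℂ} : z ∈ t.carrier ↔
    ∃ x y : ℝ, 0 ≤ x ∧ 0 ≤ y ∧ x + y ≤ 1 ∧ z = t.r + x * (t.s - t.r) + y * (t.l - t.r) := by
  constructor
  · rw [carrier, convexHull_insert (by simp), convexHull_pair]
    simp only [convexJoin_singleton_left, Set.mem_iUnion, exists_prop]
    rintro ⟨w, ⟨a, b, ha, hb, hab, rfl⟩, ⟨a', b', ha', hb', hab', rfl⟩⟩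
    refine ⟨b' * a, b' * b, by positivity, by positivity, by nlinarith, ?_⟩
    obtain rfl : a' = 1 - b' := by linarith
    obtain rfl : a = 1 - b := by linarith
    simp
    ring
  · rintro ⟨x, y, hx, hy, hxy, rfl⟩
    have hr : t.r ∈ t.carrier := subset_convexHull _ _ (by simp)
    have hs : t.s ∈ t.carrier := subset_convexHull _ _ (by simp)
    have hl : t.l ∈ t.carrier := subset_convexHull _ _ (by simp)
    have := (convex_convexHull ℝ {t.r, t.s, t.l}).sum_mem (t := (Finset.univ : Finset (Fin 3)))
      (w := ![1 - x - y, x, y]) (z := ![t.r, t.s, t.l])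
      (by intro i _; fin_cases i <;> simp <;> linarith) (by simp [Fin.sum_univ_three]; ring)
      (by intro i _; fin_cases i <;> assumption)
    have h3 : ((1 - x - y : ℝ) : ℂ) * t.r + x * t.s + y * t.l ∈ t.carrier := by
      simpa [Fin.sum_univ_three, carrier] using this
    convert h3 using 1
    push_cast
    ring

theorem carrier_subset_of_mem_subdivide {t t' : PinTriangle} (h : t' ∈ t.subdivide) :
    t'.carrier ⊆ t.carrier := by
  have key : ∀ p, (∃ x y : ℝ, 0 ≤ x ∧ 0 ≤ y ∧ x + y ≤ 1 ∧
      p = t.r + x * (t.s - t.r) + y * (t.l - t.r)) → p ∈ t.carrier := fun p => mem_carrier_iff.2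
  have hr : t.r ∈ t.carrier := key _ ⟨0, 0, by norm_num, by norm_num, by norm_num, by simp⟩
  have hs : t.s ∈ t.carrier := key _ ⟨1, 0, by norm_num, by norm_num, by norm_num, by simp⟩
  have hl : t.l ∈ t.carrier := key _ ⟨0, 1, by norm_num, by norm_num, by norm_num, by simp⟩
  have h1 : t.h₁ ∈ t.carrier :=
    key _ ⟨4 / 5, 1 / 5, by norm_num, by norm_num, by norm_num, by simp [h₁]; ring⟩
  have h2 : t.h₂ ∈ t.carrier :=
    key _ ⟨2 / 5, 3 / 5, by norm_num, by norm_num, by norm_num, by simp [h₂]; ring⟩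
  have hm : t.m ∈ t.carrier :=
    key _ ⟨0, 1 / 2, by norm_num, by norm_num, by norm_num, by simp [m]; ring⟩
  have hf : t.f ∈ t.carrier :=
    key _ ⟨2 / 5, 1 / 10, by norm_num, by norm_num, by norm_num, by simp [f, h₁]; ring⟩
  apply convexHull_min _ (convex_convexHull ℝ _)
  simp only [subdivide, Set.mem_insert_iff, Set.mem_singleton_iff] at h
  rcases h with rfl | rfl | rfl | rfl | rfl <;> rintro p (rfl | rfl | rfl) <;> assumption

theorem exists_mem_subdivide {t : PinTriangle} {z : ℂ} (h : z ∈ t.carrier) :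
    ∃ t' ∈ t.subdivide, z ∈ t'.carrier := by
  obtain ⟨x, y, hx, hy, hxy, rfl⟩ := mem_carrier_iff.1 h
  simp only [subdivide, Set.mem_insert_iff, Set.mem_singleton_iff, exists_eq_or_imp,
    exists_eq_left, mem_carrier_iff]
  by_cases c1 : 4 * y ≤ x
  · exact Or.inl ⟨x - 4 * y, 1 - x - y, by linarith, by linarith, by linarith, by
      simp [h₁]; ring⟩
  by_cases c5 : 2 + x ≤ 4 * y
  · exact .inr <| .inr <| .inr <| .inr ⟨2 * (1 - x - y), (4 * y - x - 2) / 2, by linarith, by linarith,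
      by linarith, by simp [h₂, m]; ring⟩
  by_cases c4 : 4 ≤ 3 * x + 8 * y
  · exact .inr <| .inr <| .inr <| .inl ⟨2 * (1 - x - y), (2 + x - 4 * y) / 2, by linarith, by linarith,
      by linarith, by simp [h₁, h₂, m]; ring⟩
  by_cases c2 : 2 * (x + y) ≤ 1
  · exact .inr <| .inl ⟨1 - 2 * (x + y), (4 * y - x) / 2, by linarith, by linarith,
      by linarith, by simp [h₁, f, m]; ring⟩
  · exact .inr <| .inr <| .inl ⟨2 * (x + y) - 1, (4 * y - x) / 2, by linarith, by linarith,
      by linarith, by simp [h₁, f, m]; ring⟩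

theorem carrier_subset_of_mem_iter (n : ℕ) {t t' : PinTriangle} (h : t' ∈ t.iterSubdivide n) :
    t'.carrier ⊆ t.carrier := by
  induction n generalizing t with
  | zero => rw [show t' = t from h]
  | succ n ih =>
    simp only [iterSubdivide, Set.mem_iUnion] at h
    obtain ⟨a, ha, h⟩ := h
    exact (ih h).trans (carrier_subset_of_mem_subdivide ha)

theorem exists_mem_iter (n : ℕ) {t : PinTriangle} {z : ℂ} (h : z ∈ t.carrier) :
    ∃ t' ∈ t.iterSubdivide n, z ∈ t'.carrier := by
  induction n generalizing t with
  | zero => exact ⟨t, rfl, h⟩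
  | succ n ih =>
    obtain ⟨a, ha, hz⟩ := exists_mem_subdivide h
    obtain ⟨b, hb, hz⟩ := ih hz
    exact ⟨b, Set.mem_biUnion ha hb, hz⟩

theorem hasSize_of_mem_iter (n : ℕ) {t t' : PinTriangle} (ht : t.HasSize (√5 ^ n))
    (h : t' ∈ t.iterSubdivide n) : t'.HasSize 1 := by
  induction n generalizing t with
  | zero => rw [show t' = t from h]; simpa using ht
  | succ n ih =>
    simp only [iterSubdivide, Set.mem_iUnion] at h
    obtain ⟨a, ha, h⟩ := h
    exact ih (hasSize_of_mem_subdivide (by positivity) (by rwa [← pow_succ']) ha) h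

theorem disjoint_of_mem_iter (n : ℕ) {t A B : PinTriangle} (ht : t.HasSize (√5 ^ n))
    (hA : A ∈ t.iterSubdivide n) (hB : B ∈ t.iterSubdivide n) (hAB : A ≠ B) :
    Disjoint (interior A.carrier) (interior B.carrier) := by
  induction n generalizing t with
  | zero => exact absurd ((show A = t from hA).trans (show B = t from hB).symm) hAB
  | succ n ih =>
    simp only [iterSubdivide, Set.mem_iUnion] at hA hB
    obtain ⟨a, ha, hA⟩ := hA
    obtain ⟨b, hb, hB⟩ := hB
    by_cases hab : a = b
    · subst hab
      exact ih (hasSize_of_mem_subdivide (by positivity) (by rwa [← pow_succ']) ha) hA hB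
    · exact (disjoint_of_mem_subdivide (by positivity) ht ha hb hab).mono
        (interior_mono (carrier_subset_of_mem_iter n hA))
        (interior_mono (carrier_subset_of_mem_iter n hB))

end PinTriangle

/-- There is a pinwheel tiling: the increasing union of the supertiles around the fixed point
`(1 + i) / 2` of the expansion `z ↦ (2 - i) z - 1`, which maps a tile to the level-one supertile
having it as its middle tile. -/
theorem exists_isPinwheelTiling : ∃ T, IsPinwheelTiling T := by
  set q : ℂ := 2 - Complex.I with hl
  set p : ℂ := (1 + Complex.I) / 2 with hp
  -- the n-th supertile
  let S : ℕ → PinTriangle := fun n =>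
    ⟨p + q ^ n * (0 - p), p + q ^ n * (1 - p), p + q ^ n * (2 * Complex.I - p)⟩
  have hI : Complex.I ^ 2 = -1 := Complex.I_sq
  have step : ∀ n, S n ∈ (S (n + 1)).subdivide := by
    intro n
    have : S n = ⟨(S (n+1)).f, (S (n+1)).h₁, (S (n+1)).m⟩ := by
      ext <;> simp only [S, PinTriangle.f, PinTriangle.h₁, PinTriangle.m, pow_succ] <;>
        generalize q ^ n = P <;> rw [hl, hp]
      · linear_combination (-3 / 10) * P * hI
      · linear_combination (-1 / 10) * P * hI
      · linear_combination (1 / 2) * P * hI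
    rw [this]; simp [PinTriangle.subdivide]
  have hnorm : ‖q‖ = √5 := by
    rw [hl, Complex.norm_eq_sqrt_sq_add_sq]; norm_num
  have size : ∀ n, (S n).HasSize (√5 ^ n) := by
    intro n
    have h1 : ‖(1 : ℂ) - 2 * Complex.I‖ = √5 := by
      rw [Complex.norm_eq_sqrt_sq_add_sq]; norm_num
    refine ⟨?_, ?_, ?_⟩ <;> simp only [S] <;>
      rw [dist_add_left, dist_eq_norm, ← mul_sub, norm_mul, norm_pow, hnorm, sub_sub_sub_cancel_right]
    · simp
    · simp [mul_comm]
    · rw [h1, mul_comm]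
  have mono1 : ∀ n, (S n).iterSubdivide n ⊆ (S (n + 1)).iterSubdivide (n + 1) := fun n =>
    Set.subset_biUnion_of_mem (u := fun t : PinTriangle => t.iterSubdivide n) (step n)
  have mono : Monotone fun n => (S n).iterSubdivide n := monotone_nat_of_le_succ mono1
  have fin : ∀ F ⊆ ⋃ n, (S n).iterSubdivide n, F.Finite → ∃ n, F ⊆ (S n).iterSubdivide n := by
    intro F hF hfin
    obtain ⟨n, -, hn⟩ := DirectedOn.exists_mem_subset_of_finset_subset_biUnion
      (f := fun n => (S n).iterSubdivide n) (c := Set.univ) ⟨0, trivial⟩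
      (fun a _ b _ => ⟨max a b, trivial, mono (le_max_left a b), mono (le_max_right a b)⟩)
      (s := hfin.toFinset) (by simpa using hF)
    exact ⟨n, by simpa using hn⟩
  refine ⟨⋃ n, (S n).iterSubdivide n, ?_, ?_, ?_, ?_⟩
  · intro t ht
    obtain ⟨n, hn⟩ := Set.mem_iUnion.1 ht
    exact PinTriangle.hasSize_of_mem_iter n (size n) hn
  · refine Set.eq_univ_of_forall fun z => ?_
    have pint : p ∈ interior (S 0).carrier := by
      let U : Set ℂ := {z | 0 < z.re} ∩ ({z | 0 < z.im} ∩ {z | 2 * z.re + z.im < 2})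
      have hU : IsOpen U := (isOpen_lt (by fun_prop) (by fun_prop)).inter
        ((isOpen_lt (by fun_prop) (by fun_prop)).inter (isOpen_lt (by fun_prop) (by fun_prop)))
      refine mem_interior.2 ⟨U, fun z hz => ?_, hU, ?_⟩
      · obtain ⟨a, b, c⟩ := hz
        simp only [Set.mem_ofPred_eq] at a b c
        refine PinTriangle.mem_carrier_iff.2 ⟨z.re, z.im / 2, by linarith, by linarith,
          by linarith, ?_⟩
        apply Complex.ext <;> simp [S]
      · refine ⟨?_, ?_, ?_⟩ <;> norm_num [hp]
    obtain ⟨ε, hε, hball⟩ := Metric.isOpen_iff.1 isOpen_interior p pint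
    obtain ⟨n, hn⟩ := pow_unbounded_of_one_lt (‖z - p‖ / ε)
      (Real.lt_sqrt_of_sq_lt (by norm_num) : (1 : ℝ) < √5)
    have q0 : q ^ n ≠ 0 := pow_ne_zero _ (norm_pos_iff.1 (by rw [hnorm]; positivity))
    have hw : p + (z - p) / q ^ n ∈ (S 0).carrier := by
      refine interior_subset (hball ?_)
      rw [mem_ball_iff_norm, add_sub_cancel_left, norm_div, norm_pow, hnorm,
        div_lt_comm₀ (by positivity) hε]
      exact hn
    have hz : z ∈ (S n).carrier := by
      rw [PinTriangle.mem_carrier_iff] at hw ⊢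
      obtain ⟨x, y, hx, hy, hxy, e⟩ := hw
      refine ⟨x, y, hx, hy, hxy, ?_⟩
      have e' : (z - p) / q ^ n = _ - p := eq_sub_of_add_eq' e
      rw [div_eq_iff q0] at e'
      simp only [S, pow_zero, one_mul] at e' ⊢
      linear_combination e'
    obtain ⟨t, ht, hzt⟩ := PinTriangle.exists_mem_iter n hz
    exact Set.mem_biUnion (Set.mem_iUnion.2 ⟨n, ht⟩) hzt
  · intro t ht t' ht' hne
    obtain ⟨n, hn⟩ := fin {t, t'} (by rintro x (rfl | rfl) <;> assumption) (by simp)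
    exact PinTriangle.disjoint_of_mem_iter n (size n) (hn (by simp)) (hn (by simp)) hne
  · intro F hF hfin
    obtain ⟨n, hn⟩ := fin F hF hfin
    exact ⟨n, _, ⟨S n, size n, rfl⟩, hn⟩

/-! For the upper bound, take a supertile `t` of level `n + 1` and measure vertices from `t.r` in
the unit `u = t.s - t.r`. All vertices lie in `ℤ[i][1/5] u`, since a long leg is `±2i` times the
short one and every new point of a subdivision is obtained by halving a long leg or by dividing by
5. As `‖u‖ ^ 2` is a power of 5, reduction modulo `1 + i` splits the vertices into two classes, and
two vertices with odd squared distance are in different classes.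

The squared length of an edge is 1, 5 or 4. This rests on the invariant `IsPatch`: inside a
supertile, a tile meets corners of other tiles only in its own corners and in the midpoint of its
long leg. The invariant survives subdivision because a cut point on a hypotenuse, or the midpoint of
a long leg, can lie on another triangle only in a corner of it or along a side shared with it in
full (`corner_or_common_side`).

The bad edges, of length 2, are the long legs whose midpoint is not a vertex. A third colour repairs
them: it goes to `f` of every level-one supertile, and to `h₂` of those which have no neighbour
sharing their hypotenuse in the opposite direction. Every undivided long leg has its right-angle end
in this class and its other end outside it (`mem_thirdClass_of_m_notMem`), and no edge of odd
squared length has both ends in it (`not_mem_thirdClass_and`).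

A finite part of the graph lies in a disc, where the tiling agrees with a supertile, so compactness
extends the 3-colouring to the whole graph. For the lower bound, the middle tile of a level-one
supertile has no vertex inside its sides, so its corners form a triangle of the graph. -/

namespace PinTriangle

/-! ### Affine coordinates along the legs of a triangle. -/

/-- The point with affine coordinates `x, y` along the two legs. -/
noncomputable def pt (a : PinTriangle) (x y : ℝ) : ℂ := a.r + x * (a.s - a.r) + y * (a.l - a.r)

theorem r_eq_pt (a : PinTriangle) : a.r = a.pt 0 0 := by simp [pt]
theorem s_eq_pt (a : PinTriangle) : a.s = a.pt 1 0 := by simp [pt]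
theorem l_eq_pt (a : PinTriangle) : a.l = a.pt 0 1 := by simp [pt]
theorem h₁_eq_pt (a : PinTriangle) : a.h₁ = a.pt (4 / 5) (1 / 5) := by simp [pt, h₁]; ring
theorem h₂_eq_pt (a : PinTriangle) : a.h₂ = a.pt (2 / 5) (3 / 5) := by simp [pt, h₂]; ring
theorem m_eq_pt (a : PinTriangle) : a.m = a.pt 0 (1 / 2) := by simp [pt, m]; ring
theorem f_eq_pt (a : PinTriangle) : a.f = a.pt (2 / 5) (1 / 10) := by simp [pt, f, h₁]; ring

theorem mem_carrier_iff_pt {a : PinTriangle} {z : ℂ} : z ∈ a.carrier ↔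
    ∃ x y : ℝ, 0 ≤ x ∧ 0 ≤ y ∧ x + y ≤ 1 ∧ z = a.pt x y := mem_carrier_iff

theorem l_sub_r {a : PinTriangle} {c : ℝ} (hc : 0 < c) (ha : a.HasSize c) :
    a.l - a.r = 2 * Complex.I * (a.s - a.r) ∨ a.l - a.r = -(2 * Complex.I * (a.s - a.r)) := by
  rw [hasSize_iff hc.le] at ha
  obtain ⟨h1, h2, h3⟩ := ha
  obtain ⟨x, hx⟩ : ∃ x, x = a.s.re - a.r.re := ⟨_, rfl⟩
  obtain ⟨y, hy⟩ : ∃ y, y = a.s.im - a.r.im := ⟨_, rfl⟩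
  obtain ⟨p, hp⟩ : ∃ p, p = a.l.re - a.r.re := ⟨_, rfl⟩
  obtain ⟨q, hq⟩ : ∃ q, q = a.l.im - a.r.im := ⟨_, rfl⟩
  have e1 : x ^ 2 + y ^ 2 = c ^ 2 := by rw [hx, hy]; linarith
  have e2 : p ^ 2 + q ^ 2 = 4 * c ^ 2 := by rw [hp, hq]; linarith
  have e3 : x * p + y * q = 0 := by
    subst hx hy hp hq; linear_combination (h1 + h2 - h3) / 2
  -- Lagrange's identity: for orthogonal legs the squared determinant is the product of the squared
  -- lengths. Its sign decides the orientation.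
  have e4 : (x * q - y * p - 2 * c ^ 2) * (x * q - y * p + 2 * c ^ 2) = 0 := by
    linear_combination (4 * c ^ 2) * e1 + (x ^ 2 + y ^ 2) * e2 - (x * p + y * q) * e3
  rcases mul_eq_zero.1 e4 with h | h
  · left
    have : (p + 2 * y) ^ 2 + (q - 2 * x) ^ 2 = 0 := by
      linear_combination 4 * e1 + e2 - 4 * h
    have k1 : p + 2 * y = 0 := pow_eq_zero_iff two_ne_zero |>.1 (by linarith [sq_nonneg (p + 2 * y), sq_nonneg (q - 2 * x)])
    have k2 : q - 2 * x = 0 := pow_eq_zero_iff two_ne_zero |>.1 (by linarith [sq_nonneg (p + 2 * y), sq_nonneg (q - 2 * x)])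
    apply Complex.ext <;> simp [← hx, ← hy, ← hp, ← hq] <;> linarith
  · right
    have : (p - 2 * y) ^ 2 + (q + 2 * x) ^ 2 = 0 := by
      linear_combination 4 * e1 + e2 + 4 * h
    have k1 : p - 2 * y = 0 := pow_eq_zero_iff two_ne_zero |>.1 (by linarith [sq_nonneg (p - 2 * y), sq_nonneg (q + 2 * x)])
    have k2 : q + 2 * x = 0 := pow_eq_zero_iff two_ne_zero |>.1 (by linarith [sq_nonneg (p - 2 * y), sq_nonneg (q + 2 * x)])
    apply Complex.ext <;> simp [← hx, ← hy, ← hp, ← hq] <;> linarith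

theorem s_sub_r_ne_zero {a : PinTriangle} {c : ℝ} (hc : 0 < c) (ha : a.HasSize c) :
    a.s - a.r ≠ 0 := by
  intro h
  have := ha.1
  rw [dist_comm, dist_eq_norm, h, norm_zero] at this
  exact hc.ne this

theorem pt_inj {a : PinTriangle} {c : ℝ} (hc : 0 < c) (ha : a.HasSize c) {x y x' y' : ℝ} :
    a.pt x y = a.pt x' y' ↔ x = x' ∧ y = y' := by
  refine ⟨fun h => ?_, by rintro ⟨rfl, rfl⟩; rfl⟩
  have u0 := s_sub_r_ne_zero hc ha
  unfold pt at h
  rcases l_sub_r hc ha with e | e <;> rw [e] at h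
  · have : ((x - x' : ℝ) + (2 * (y - y') : ℝ) * Complex.I : ℂ) = 0 := by
      apply mul_right_cancel₀ u0
      push_cast
      linear_combination h
    have h1 := congrArg Complex.re this
    have h2 := congrArg Complex.im this
    simp at h1 h2
    exact ⟨by linarith, by linarith⟩
  · have : ((x - x' : ℝ) - (2 * (y - y') : ℝ) * Complex.I : ℂ) = 0 := by
      apply mul_right_cancel₀ u0
      push_cast
      linear_combination h
    have h1 := congrArg Complex.re this
    have h2 := congrArg Complex.im this
    simp at h1 h2
    exact ⟨by linarith, by linarith⟩

theorem pt_mem_carrier_pt {a : PinTriangle} {c : ℝ} (hc : 0 < c) (ha : a.HasSize c)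
    {x y x₁ y₁ x₂ y₂ x₃ y₃ : ℝ}
    (h : a.pt x y ∈ carrier ⟨a.pt x₁ y₁, a.pt x₂ y₂, a.pt x₃ y₃⟩) :
    ∃ p q : ℝ, 0 ≤ p ∧ 0 ≤ q ∧ p + q ≤ 1 ∧ x = x₁ + p * (x₂ - x₁) + q * (x₃ - x₁) ∧
      y = y₁ + p * (y₂ - y₁) + q * (y₃ - y₁) := by
  obtain ⟨p, q, hp, hq, hpq, e⟩ := mem_carrier_iff.1 h
  refine ⟨p, q, hp, hq, hpq, (pt_inj hc ha).1 (e.trans ?_)⟩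
  simp only [pt]
  push_cast
  ring

/-- The corner or the midpoint of the long leg: the only places where another tile of a patch may
have a corner. -/
def CornerOrMid (a : PinTriangle) (z : ℂ) : Prop := z ∈ a.corners ∨ z = a.m

theorem cornerOrMid_pt_iff {a b : PinTriangle} {x₁ y₁ x₂ y₂ x₃ y₃ : ℝ}
    (hb : b = ⟨a.pt x₁ y₁, a.pt x₂ y₂, a.pt x₃ y₃⟩) {z : ℂ} : b.CornerOrMid z ↔
      z = a.pt x₁ y₁ ∨ z = a.pt x₂ y₂ ∨ z = a.pt x₃ y₃ ∨
        z = a.pt ((x₁ + x₃) / 2) ((y₁ + y₃) / 2) := by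
  subst hb
  have : m ⟨a.pt x₁ y₁, a.pt x₂ y₂, a.pt x₃ y₃⟩ = a.pt ((x₁ + x₃) / 2) ((y₁ + y₃) / 2) := by
    simp [m, pt]; ring
  simp [CornerOrMid, corners, this, or_assoc]

/-- The points of `a` at which the tiles of a subdivided patch containing `a` have corners. -/
def nodes (a : PinTriangle) : Set ℂ :=
  {a.r, a.s, a.l, a.h₁, a.h₂, a.m, a.f, (3 * a.s + 2 * a.l) / 5, (a.s + 4 * a.l) / 5}

/-- A finite check of nine points against five tiles. The last two nodes are `h₂` and `h₁` of a
neighbour with reversed hypotenuse; they bisect the long legs of the two tiles with right angle at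
`a.h₂`. -/
theorem cornerOrMid_of_mem_nodes {a b : PinTriangle} {c : ℝ} (hc : 0 < c) (ha : a.HasSize c)
    (hb : b ∈ a.subdivide) {z : ℂ} (hz : z ∈ a.nodes) (hzb : z ∈ b.carrier) : b.CornerOrMid z := by
  have g₁ : (3 * a.s + 2 * a.l) / 5 = a.pt (3 / 5) (2 / 5) := by simp [pt]; ring
  have g₂ : (a.s + 4 * a.l) / 5 = a.pt (1 / 5) (4 / 5) := by simp [pt]; ring
  have e := @pt_inj a c hc ha
  simp only [nodes, g₁, g₂, Set.mem_insert_iff, Set.mem_singleton_iff] at hz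
  simp only [h₁_eq_pt, h₂_eq_pt, m_eq_pt, f_eq_pt] at hz
  rw [r_eq_pt, s_eq_pt, l_eq_pt] at hz
  simp only [subdivide, Set.mem_insert_iff, Set.mem_singleton_iff] at hb
  simp only [h₁_eq_pt, h₂_eq_pt, m_eq_pt, f_eq_pt] at hb
  rw [r_eq_pt, s_eq_pt, l_eq_pt] at hb
  rcases hb with hb | hb | hb | hb | hb <;> rw [cornerOrMid_pt_iff hb] <;> rw [hb] at hzb <;>
  clear hb g₁ g₂ <;>
  rcases hz with rfl | rfl | rfl | rfl | rfl | rfl | rfl | rfl | rfl <;>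
  simp only [e] <;> norm_num <;>
  · obtain ⟨p, q, h1, h2, h3, h4, h5⟩ := pt_mem_carrier_pt hc ha hzb
    linarith

/-! ### Interiors and separating lines. -/

theorem pt_mem_interior {a : PinTriangle} {c : ℝ} (hc : 0 < c) (ha : a.HasSize c) {x y : ℝ}
    (hx : 0 < x) (hy : 0 < y) (hxy : x + y < 1) : a.pt x y ∈ interior a.carrier := by
  have u0 := s_sub_r_ne_zero hc ha
  obtain ⟨ε, hε, e⟩ : ∃ ε : ℝ, ε ^ 2 = 1 ∧ a.l - a.r = 2 * ε * Complex.I * (a.s - a.r) := by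
    rcases l_sub_r hc ha with e | e
    · exact ⟨1, by norm_num, by rw [e]; simp⟩
    · exact ⟨-1, by norm_num, by rw [e]; simp⟩
  have hpt : ∀ x y : ℝ, a.pt x y = a.r + (x + 2 * ε * y * Complex.I) * (a.s - a.r) := by
    intro x y
    rw [pt, e]; ring
  let w : ℂ → ℂ := fun z => (z - a.r) / (a.s - a.r)
  have hw : Continuous w := by fun_prop
  let U : Set ℂ := {z | 0 < (w z).re} ∩ ({z | 0 < ε * (w z).im} ∩
    {z | (w z).re + ε * (w z).im / 2 < 1})
  have hU : IsOpen U := (isOpen_lt (by fun_prop) (by fun_prop)).inter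
    ((isOpen_lt (by fun_prop) (by fun_prop)).inter (isOpen_lt (by fun_prop) (by fun_prop)))
  refine mem_interior.2 ⟨U, fun z hz => ?_, hU, ?_⟩
  · obtain ⟨h1, h2, h3⟩ := hz
    simp only [Set.mem_ofPred_eq] at h1 h2 h3
    refine mem_carrier_iff_pt.2 ⟨(w z).re, ε * (w z).im / 2, by linarith, by linarith,
      by linarith, ?_⟩
    rw [hpt]
    have : ((w z).re + 2 * ε * ↑(ε * (w z).im / 2) * Complex.I : ℂ) = w z := by
      apply Complex.ext <;> simp
      linear_combination (w z).im * hε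
    rw [this]
    simp only [w]
    field_simp
    ring
  · have : w (a.pt x y) = x + 2 * ε * y * Complex.I := by
      simp only [w, hpt]
      field_simp
      ring
    refine ⟨?_, ?_, ?_⟩ <;> simp [this]
    · exact hx
    · nlinarith
    · nlinarith

theorem interior_nonempty {a : PinTriangle} {c : ℝ} (hc : 0 < c) (ha : a.HasSize c) :
    (interior a.carrier).Nonempty :=
  ⟨_, pt_mem_interior hc ha (x := 1 / 3) (y := 1 / 3) (by norm_num) (by norm_num) (by norm_num)⟩

theorem convex_carrier (a : PinTriangle) : Convex ℝ a.carrier := convex_convexHull ℝ _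

theorem corner_mem_carrier {a : PinTriangle} {z : ℂ} (hz : z ∈ a.corners) : z ∈ a.carrier :=
  subset_convexHull ℝ _ hz

theorem carrier_subset_closure_interior {a : PinTriangle} {c : ℝ} (hc : 0 < c) (ha : a.HasSize c) :
    a.carrier ⊆ closure (interior a.carrier) := by
  rw [(convex_carrier a).closure_interior_eq_closure_of_nonempty_interior (interior_nonempty hc ha)]
  exact subset_closure

/-- Two triangles with disjoint interiors lie on different sides of a line. -/
theorem exists_separating {a b : PinTriangle} {c d : ℝ} (hc : 0 < c) (ha : a.HasSize c)
    (hd : 0 < d) (hb : b.HasSize d) (hab : Disjoint (interior a.carrier) (interior b.carrier)) :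
    ∃ (φ : ℂ →L[ℝ] ℝ) (u : ℝ), φ ≠ 0 ∧ (∀ z ∈ a.carrier, φ z ≤ u) ∧ ∀ z ∈ b.carrier, u ≤ φ z := by
  obtain ⟨φ, u, h1, h2⟩ := geometric_hahn_banach_open_open (convex_carrier a).interior
    isOpen_interior (convex_carrier b).interior isOpen_interior hab
  refine ⟨φ, u, ?_, fun z hz => ?_, fun z hz => ?_⟩
  · rintro rfl
    obtain ⟨p, hp⟩ := interior_nonempty hc ha
    obtain ⟨q, hq⟩ := interior_nonempty hd hb
    have i1 := h1 p hp
    have i2 := h2 q hq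
    simp at i1 i2
    linarith
  · exact closure_minimal (fun z hz => (h1 z hz).le) (isClosed_le φ.continuous continuous_const)
      (carrier_subset_closure_interior hc ha hz)
  · exact closure_minimal (fun z hz => (h2 z hz).le) (isClosed_le continuous_const φ.continuous)
      (carrier_subset_closure_interior hd hb hz)

theorem map_pt (φ : ℂ →L[ℝ] ℝ) (a : PinTriangle) (x y : ℝ) :
    φ (a.pt x y) = (1 - x - y) * φ a.r + x * φ a.s + y * φ a.l := by
  have : a.pt x y = a.r + x • (a.s - a.r) + y • (a.l - a.r) := by simp [pt]
  rw [this]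
  simp only [map_add, map_smul, map_sub, smul_eq_mul]
  ring

theorem not_const_of_ne_zero {a : PinTriangle} {c : ℝ} (hc : 0 < c) (ha : a.HasSize c)
    {φ : ℂ →L[ℝ] ℝ} (hφ : φ ≠ 0) {u : ℝ} (hr : φ a.r = u) (hs : φ a.s = u) (hl : φ a.l = u) :
    False := by
  have u0 := s_sub_r_ne_zero hc ha
  have h1 : φ (a.s - a.r) = 0 := by rw [map_sub, hr, hs, sub_self]
  have h2 : φ (a.l - a.r) = 0 := by rw [map_sub, hr, hl, sub_self]
  have h3 : φ (Complex.I * (a.s - a.r)) = 0 := by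
    rcases l_sub_r hc ha with e | e
    · have : a.l - a.r = (2 : ℝ) • (Complex.I * (a.s - a.r)) := by rw [e]; simp; ring
      rw [this, map_smul, smul_eq_mul] at h2
      linarith
    · have : a.l - a.r = (-2 : ℝ) • (Complex.I * (a.s - a.r)) := by rw [e]; simp; ring
      rw [this, map_smul, smul_eq_mul] at h2
      linarith
  apply hφ
  ext z
  have : z = (z / (a.s - a.r)).re • (a.s - a.r) +
      (z / (a.s - a.r)).im • (Complex.I * (a.s - a.r)) := by
    conv_lhs => rw [← div_mul_cancel₀ z u0, ← Complex.re_add_im (z / (a.s - a.r))]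
    simp only [Complex.real_smul]
    ring
  rw [this, map_add, map_smul, map_smul, h1, h3]
  simp

/-! ### Sides of two triangles on a common line. -/

/-- `p` and `q` are the ends of a side of relative length `L`. -/
def IsSide (a : PinTriangle) (p q : ℂ) (L : ℝ) : Prop :=
  (p = a.r ∧ q = a.s ∧ L = 1) ∨ (p = a.r ∧ q = a.l ∧ L = 2) ∨ (p = a.s ∧ q = a.l ∧ L = √5)

theorem two_lt_sqrt_five : (2 : ℝ) < √5 := Real.lt_sqrt_of_sq_lt (by norm_num)

theorem IsSide.dist_eq {a : PinTriangle} {p q : ℂ} {L c : ℝ} (h : a.IsSide p q L)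
    (ha : a.HasSize c) : dist p q = L * c := by
  rcases h with ⟨rfl, rfl, rfl⟩ | ⟨rfl, rfl, rfl⟩ | ⟨rfl, rfl, rfl⟩
  · rw [ha.1, one_mul]
  · exact ha.2.1
  · exact ha.2.2

theorem IsSide.length {a : PinTriangle} {p q : ℂ} {L : ℝ} (h : a.IsSide p q L) :
    L = 1 ∨ L = 2 ∨ L = √5 := by
  rcases h with ⟨-, -, h⟩ | ⟨-, -, h⟩ | ⟨-, -, h⟩ <;> simp [h]

theorem IsSide.corners {a : PinTriangle} {p q : ℂ} {L : ℝ} (h : a.IsSide p q L) :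
    p ∈ a.corners ∧ q ∈ a.corners := by
  rcases h with ⟨rfl, rfl, -⟩ | ⟨rfl, rfl, -⟩ | ⟨rfl, rfl, -⟩ <;> simp [PinTriangle.corners]

theorem IsSide.lineMap_mem {a : PinTriangle} {p q : ℂ} {L : ℝ} (h : a.IsSide p q L) {t : ℝ}
    (h0 : 0 ≤ t) (h1 : t ≤ 1) : p + t * (q - p) ∈ a.carrier := by
  have := (convex_carrier a) (corner_mem_carrier h.corners.1) (corner_mem_carrier h.corners.2)
    (sub_nonneg.2 h1) h0 (by ring)
  convert this using 1
  simp
  ring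

theorem IsSide.cornerOrMid {a : PinTriangle} {c : ℝ} (hc : 0 < c) (ha : a.HasSize c) {p q : ℂ}
    {L : ℝ} (h : a.IsSide p q L) {t : ℝ} (ht : a.CornerOrMid (p + t * (q - p))) :
    t = 0 ∨ t = 1 ∨ (L = 2 ∧ t = 1 / 2) := by
  have e := @pt_inj a c hc ha
  obtain ⟨x, y, x', y', hp, hq, h⟩ : ∃ x y x' y' : ℝ, p = a.pt x y ∧ q = a.pt x' y' ∧
      ((x = 0 ∧ y = 0 ∧ x' = 1 ∧ y' = 0 ∧ L = 1) ∨ (x = 0 ∧ y = 0 ∧ x' = 0 ∧ y' = 1 ∧ L = 2) ∨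
        (x = 1 ∧ y = 0 ∧ x' = 0 ∧ y' = 1 ∧ L = √5)) := by
    rcases h with ⟨rfl, rfl, rfl⟩ | ⟨rfl, rfl, rfl⟩ | ⟨rfl, rfl, rfl⟩
    · exact ⟨0, 0, 1, 0, r_eq_pt a, s_eq_pt a, by simp⟩
    · exact ⟨0, 0, 0, 1, r_eq_pt a, l_eq_pt a, by simp⟩
    · exact ⟨1, 0, 0, 1, s_eq_pt a, l_eq_pt a, by simp⟩
  have : p + t * (q - p) = a.pt (x + t * (x' - x)) (y + t * (y' - y)) := by
    rw [hp, hq]; simp only [pt]; push_cast; ring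
  rw [this, CornerOrMid, PinTriangle.corners, m_eq_pt] at ht
  simp only [Set.mem_insert_iff, Set.mem_singleton_iff] at ht
  rw [r_eq_pt, s_eq_pt, l_eq_pt, e, e, e, e] at ht
  rcases h with ⟨rfl, rfl, rfl, rfl, rfl⟩ | ⟨rfl, rfl, rfl, rfl, rfl⟩ | ⟨rfl, rfl, rfl, rfl, rfl⟩ <;>
    norm_num at ht ⊢ <;> grind

/-- Where a point of a triangle on a supporting line can be. -/
theorem corner_or_side {a : PinTriangle} {c : ℝ} (hc : 0 < c) (ha : a.HasSize c)
    {φ : ℂ →L[ℝ] ℝ} (hφ : φ ≠ 0) {u : ℝ} (hu : ∀ z ∈ a.carrier, φ z ≤ u) {z : ℂ}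
    (hz : z ∈ a.carrier) (hzu : φ z = u) : z ∈ a.corners ∨ ∃ (p q : ℂ) (L ζ : ℝ), a.IsSide p q L ∧
      0 < ζ ∧ ζ < 1 ∧ z = p + ζ * (q - p) ∧ φ p = u ∧ φ q = u := by
  obtain ⟨x, y, hx, hy, hxy, rfl⟩ := mem_carrier_iff_pt.1 hz
  have hr : φ a.r ≤ u := hu _ (corner_mem_carrier (by simp [corners]))
  have hs : φ a.s ≤ u := hu _ (corner_mem_carrier (by simp [corners]))
  have hl : φ a.l ≤ u := hu _ (corner_mem_carrier (by simp [corners]))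
  rw [map_pt] at hzu
  have k1 : 0 ≤ (1 - x - y) * (u - φ a.r) := mul_nonneg (by linarith) (by linarith)
  have k2 : 0 ≤ x * (u - φ a.s) := mul_nonneg (by linarith) (by linarith)
  have k3 : 0 ≤ y * (u - φ a.l) := mul_nonneg (by linarith) (by linarith)
  have j1 : (1 - x - y) * (u - φ a.r) = 0 := by linarith
  have j2 : x * (u - φ a.s) = 0 := by linarith
  have j3 : y * (u - φ a.l) = 0 := by linarith
  rcases eq_or_lt_of_le hx with rfl | hx
  · rcases eq_or_lt_of_le hy with rfl | hy
    · left; simp [pt, corners]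
    · have hl' : φ a.l = u := by
        rcases mul_eq_zero.1 j3 with h | h <;> linarith
      rcases eq_or_lt_of_le hxy with h | h
      · left
        obtain rfl : y = 1 := by linarith
        simp [pt, corners]
      · right
        refine ⟨a.r, a.l, 2, y, .inr (.inl ⟨rfl, rfl, rfl⟩), hy, by linarith, by simp [pt], ?_, hl'⟩
        rcases mul_eq_zero.1 j1 with h | h <;> linarith
  · have hs' : φ a.s = u := by
      rcases mul_eq_zero.1 j2 with h | h <;> linarith
    rcases eq_or_lt_of_le hy with rfl | hy
    · rcases eq_or_lt_of_le hxy with h | h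
      · left
        obtain rfl : x = 1 := by linarith
        simp [pt, corners]
      · right
        refine ⟨a.r, a.s, 1, x, .inl ⟨rfl, rfl, rfl⟩, hx, by linarith, by simp [pt], ?_, hs'⟩
        rcases mul_eq_zero.1 j1 with h | h <;> linarith
    · have hl' : φ a.l = u := by
        rcases mul_eq_zero.1 j3 with h | h <;> linarith
      rcases eq_or_lt_of_le hxy with h | h
      · right
        refine ⟨a.s, a.l, √5, y, .inr (.inr ⟨rfl, rfl, rfl⟩), hy, by linarith, ?_, hs', hl'⟩
        obtain rfl : x = 1 - y := by linarith
        simp [pt]; ring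
      · refine absurd ?_ (fun h => not_const_of_ne_zero hc ha hφ h hs' hl')
        rcases mul_eq_zero.1 j1 with h | h <;> linarith

theorem exists_real_mul_of_ker {φ : ℂ →L[ℝ] ℝ} (hφ : φ ≠ 0) {v w : ℂ} (hv : v ≠ 0)
    (h1 : φ v = 0) (h2 : φ w = 0) : ∃ x : ℝ, w = x * v := by
  refine ⟨(w / v).re, ?_⟩
  have hw : w = (w / v).re * v + (w / v).im * (Complex.I * v) := by
    conv_lhs => rw [← div_mul_cancel₀ w hv, ← Complex.re_add_im (w / v)]
    ring
  have h3 : (w / v).im * φ (Complex.I * v) = 0 := by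
    have := h2
    rw [hw, ← Complex.real_smul, ← Complex.real_smul, map_add, map_smul, map_smul, h1] at this
    simpa using this
  rcases mul_eq_zero.1 h3 with h | h
  · rw [hw, h]
    simp [hv]
  · refine absurd ?_ hφ
    ext z
    have : z = (z / v).re • v + (z / v).im • (Complex.I * v) := by
      conv_lhs => rw [← div_mul_cancel₀ z hv, ← Complex.re_add_im (z / v)]
      simp only [Complex.real_smul]
      ring
    rw [this, map_add, map_smul, map_smul, h1, h]
    simp

/-- How two overlapping sides on a common line, of lengths `L` and `L'`, can lie. The positions
`x, y` of the ends of the second are relative to the first. -/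
theorem overlapping_sides_aux {L L' x y η : ℝ} (hL : L = 1 ∨ L = 2 ∨ L = √5)
    (hη : L' = √5 ∨ (L' = 2 ∧ η = 1 / 2)) (h0 : 0 < η) (h1 : η < 1) (hxy : x < y)
    (hlen : (y - x) * L = L')
    (hx : 0 ≤ x → x ≤ 1 → x = 0 ∨ x = 1 ∨ (L = 2 ∧ x = 1 / 2))
    (hy : 0 ≤ y → y ≤ 1 → y = 0 ∨ y = 1 ∨ (L = 2 ∧ y = 1 / 2))
    (h : ∀ t, 0 ≤ t → t ≤ 1 → x + t * (y - x) = 0 ∨ x + t * (y - x) = 1 →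
      t = 0 ∨ t = 1 ∨ (L' = 2 ∧ t = 1 / 2))
    (hz0 : 0 < x + η * (y - x)) (hz1 : x + η * (y - x) < 1) : L = L' ∧ x = 0 ∧ y = 1 := by
  have s5 := two_lt_sqrt_five
  have d0 : 0 < y - x := sub_pos.2 hxy
  -- Otherwise the end 0 of the first side lies inside the second, strictly before the point with
  -- parameter `η`. It must then be the midpoint of a long leg, but in that case `η = 1 / 2` is the
  -- midpoint as well. The bound `y ≤ 1` is symmetric.
  have x0 : 0 ≤ x := by
    by_contra! hneg
    have e : -x / (y - x) * (y - x) = -x := div_mul_cancel₀ _ d0.ne'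
    have p0 : 0 < -x / (y - x) := div_pos (by linarith) d0
    have p1 : -x / (y - x) < η := by rw [div_lt_iff₀ d0]; linarith
    rcases h (-x / (y - x)) p0.le (by linarith) (by left; linarith) with h | h | ⟨h2, h⟩
    · linarith
    · linarith
    · rcases hη with hη | ⟨-, hη⟩ <;> linarith
  have y1 : y ≤ 1 := by
    by_contra! hneg
    have e : (1 - x) / (y - x) * (y - x) = 1 - x := div_mul_cancel₀ _ d0.ne'
    have p0 : (1 - x) / (y - x) < 1 := by rw [div_lt_iff₀ d0]; linarith
    have p1 : η < (1 - x) / (y - x) := by rw [lt_div_iff₀ d0]; linarith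
    rcases h ((1 - x) / (y - x)) (by linarith) p0.le (by right; linarith) with h | h | ⟨h2, h⟩
    · linarith
    · linarith
    · rcases hη with hη | ⟨-, hη⟩ <;> linarith
  -- The second side is now contained in the first. If it were a proper part, it would be half of a
  -- long leg, of length 1, whereas `L'` is 2 or `√5`.
  rcases hx x0 (by linarith) with rfl | rfl | ⟨rfl, rfl⟩
  · rcases hy (by linarith) y1 with rfl | rfl | ⟨rfl, rfl⟩
    · linarith
    · exact ⟨by linarith, rfl, rfl⟩
    · rcases hη with hη | ⟨hη, -⟩ <;> linarith
  · linarith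
  · rcases hη with hη | ⟨hη, -⟩ <;> linarith

theorem overlapping_sides {L L' x y η : ℝ} (hL : L = 1 ∨ L = 2 ∨ L = √5)
    (hη : L' = √5 ∨ (L' = 2 ∧ η = 1 / 2)) (h0 : 0 < η) (h1 : η < 1)
    (hlen : |y - x| * L = L')
    (hx : 0 ≤ x → x ≤ 1 → x = 0 ∨ x = 1 ∨ (L = 2 ∧ x = 1 / 2))
    (hy : 0 ≤ y → y ≤ 1 → y = 0 ∨ y = 1 ∨ (L = 2 ∧ y = 1 / 2))
    (h : ∀ t, 0 ≤ t → t ≤ 1 → x + t * (y - x) = 0 ∨ x + t * (y - x) = 1 →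
      t = 0 ∨ t = 1 ∨ (L' = 2 ∧ t = 1 / 2))
    (hz0 : 0 < x + η * (y - x)) (hz1 : x + η * (y - x) < 1) :
    L = L' ∧ ((x = 0 ∧ y = 1) ∨ (x = 1 ∧ y = 0)) := by
  have s5 := two_lt_sqrt_five
  rcases lt_trichotomy x y with hxy | rfl | hxy
  · rw [abs_of_pos (by linarith)] at hlen
    obtain ⟨e, h⟩ := overlapping_sides_aux hL hη h0 h1 hxy hlen hx hy h hz0 hz1
    exact ⟨e, .inl h⟩
  · rw [sub_self, abs_zero, zero_mul] at hlen
    rcases hη with hη | ⟨hη, -⟩ <;> linarith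
  · rw [abs_of_neg (by linarith), neg_sub] at hlen
    obtain ⟨e, h⟩ := overlapping_sides_aux (η := 1 - η) hL
      (hη.imp_right fun h => ⟨h.1, by linarith⟩) (by linarith) (by linarith) hxy hlen hy hx
      (fun t t0 t1 ht => by
        rcases h (1 - t) (by linarith) (by linarith) (by
          rcases ht with ht | ht
          · left; linarith
          · right; linarith) with h | h | ⟨h, h'⟩
        · right; left; linarith
        · left; linarith
        · right; right; exact ⟨h, by linarith⟩) (by linarith) (by linarith)
    exact ⟨e, .inr h.symm⟩

/-- A point of a side of `b`, either on the hypotenuse or the midpoint of the long leg, can lie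
on `a` only in a corner of `a` or when `a` shares that side. -/
theorem corner_or_common_side {a b : PinTriangle} {c : ℝ} (hc : 0 < c) (ha : a.HasSize c)
    (hb : b.HasSize c) (hd : Disjoint (interior a.carrier) (interior b.carrier))
    (hab : ∀ z ∈ b.corners, z ∈ a.carrier → a.CornerOrMid z)
    (hba : ∀ z ∈ a.corners, z ∈ b.carrier → b.CornerOrMid z)
    {p' q' : ℂ} {L' η : ℝ} (hs : b.IsSide p' q' L') (hη : L' = √5 ∨ (L' = 2 ∧ η = 1 / 2))
    (h0 : 0 < η) (h1 : η < 1) (hz : p' + η * (q' - p') ∈ a.carrier) :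
    p' + η * (q' - p') ∈ a.corners ∨
      ∃ p q, a.IsSide p q L' ∧ ((p' = p ∧ q' = q) ∨ (p' = q ∧ q' = p)) := by
  obtain ⟨φ, u, hφ, ua, ub⟩ := exists_separating hc ha hc hb hd
  have up := ub _ (corner_mem_carrier hs.corners.1)
  have uq := ub _ (corner_mem_carrier hs.corners.2)
  have e : φ (p' + η * (q' - p')) = (1 - η) * φ p' + η * φ q' := by
    rw [← Complex.real_smul, map_add, map_smul, map_sub, smul_eq_mul]; ring
  have hzu := ua _ hz
  have i1 : 0 ≤ (1 - η) * (φ p' - u) := mul_nonneg (by linarith) (by linarith)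
  have i2 : 0 ≤ η * (φ q' - u) := mul_nonneg (by linarith) (by linarith)
  -- The separating line touches `b` at a point strictly inside a side, hence contains that whole
  -- side.
  have hzu' : φ (p' + η * (q' - p')) = u := by linarith
  have up' : φ p' = u := by nlinarith
  have uq' : φ q' = u := by nlinarith
  rcases corner_or_side hc ha hφ ua hz hzu' with h | ⟨p, q, L, ζ, hS, ζ0, ζ1, ez, hp, hq⟩
  · exact .inl h
  right
  have s5 := two_lt_sqrt_five
  have Lpos : 0 < L := by rcases hS.length with h | h | h <;> linarith
  have dpq := hS.dist_eq ha
  have hpq : q - p ≠ 0 := by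
    intro h
    rw [sub_eq_zero.1 h, dist_self] at dpq
    exact (mul_pos Lpos hc).ne dpq
  obtain ⟨x, hx⟩ := exists_real_mul_of_ker hφ hpq (by rw [map_sub, hp, hq, sub_self])
    (show φ (p' - p) = 0 by rw [map_sub, hp, up', sub_self])
  obtain ⟨y, hy⟩ := exists_real_mul_of_ker hφ hpq (by rw [map_sub, hp, hq, sub_self])
    (show φ (q' - p) = 0 by rw [map_sub, hp, uq', sub_self])
  have hx' : p' = p + x * (q - p) := by rw [← hx]; ring
  have hy' : q' = p + y * (q - p) := by rw [← hy]; ring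
  have hlen : |y - x| * L = L' := by
    have d' := hs.dist_eq hb
    have : q' - p' = ((y - x : ℝ) : ℂ) * (q - p) := by rw [hx', hy']; push_cast; ring
    rw [dist_comm, dist_eq_norm, this, norm_mul, Complex.norm_real, Real.norm_eq_abs,
      ← dist_eq_norm, dist_comm, dpq] at d'
    apply mul_right_cancel₀ hc.ne'
    linarith
  have hζ : ζ = x + η * (y - x) := by
    have : ((ζ : ℝ) : ℂ) = ((x + η * (y - x) : ℝ) : ℂ) := by
      apply mul_right_cancel₀ hpq
      rw [hx', hy'] at ez
      push_cast
      linear_combination -ez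
    exact_mod_cast this
  have key := overlapping_sides hS.length hη h0 h1 hlen
    (fun t0 t1 => hS.cornerOrMid hc ha (hx' ▸ hab _ hs.corners.1 (hx' ▸ hS.lineMap_mem t0 t1)))
    (fun t0 t1 => hS.cornerOrMid hc ha (hy' ▸ hab _ hs.corners.2 (hy' ▸ hS.lineMap_mem t0 t1)))
    (fun t t0 t1 ht => by
      have et : p' + t * (q' - p') = p + ((x + t * (y - x) : ℝ) : ℂ) * (q - p) := by
        rw [hx', hy']; push_cast; ring
      refine hs.cornerOrMid hc hb (hba _ ?_ (hs.lineMap_mem t0 t1))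
      rw [et]
      rcases ht with ht | ht <;> rw [ht]
      · simpa using hS.corners.1
      · simpa using hS.corners.2)
    (hζ ▸ ζ0) (hζ ▸ ζ1)
  obtain ⟨rfl, h⟩ := key
  refine ⟨p, q, hS, ?_⟩
  rcases h with ⟨rfl, rfl⟩ | ⟨rfl, rfl⟩
  · left; constructor
    · simpa using hx'
    · simpa using hy'
  · right; constructor
    · simpa using hx'
    · simpa using hy'

/-! ### Patches and their subdivision. -/

/-- A family of triangles of one size with disjoint interiors, which have corners of each other only
in corners and in midpoints of long legs. -/
structure IsPatch (Q : Set PinTriangle) (c : ℝ) : Prop where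
  hasSize : ∀ a ∈ Q, a.HasSize c
  disjoint : ∀ a ∈ Q, ∀ b ∈ Q, a ≠ b → Disjoint (interior a.carrier) (interior b.carrier)
  cornerOrMid : ∀ a ∈ Q, ∀ b ∈ Q, ∀ z ∈ b.corners, z ∈ a.carrier → a.CornerOrMid z

theorem disjoint_interior_carrier {a b : PinTriangle} {c : ℝ} (hc : 0 < c) (ha : a.HasSize c)
    (h : Disjoint (interior a.carrier) (interior b.carrier)) :
    Disjoint a.carrier (interior b.carrier) :=
  (h.closure_left isOpen_interior).mono_left (carrier_subset_closure_interior hc ha)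

theorem f_mem_interior {a : PinTriangle} {c : ℝ} (hc : 0 < c) (ha : a.HasSize c) :
    a.f ∈ interior a.carrier := by
  rw [f_eq_pt]
  exact pt_mem_interior hc ha (by norm_num) (by norm_num) (by norm_num)

theorem h₁_mem_carrier (a : PinTriangle) : a.h₁ ∈ a.carrier :=
  mem_carrier_iff_pt.2 ⟨_, _, by norm_num, by norm_num, by norm_num, a.h₁_eq_pt⟩

theorem h₂_mem_carrier (a : PinTriangle) : a.h₂ ∈ a.carrier :=
  mem_carrier_iff_pt.2 ⟨_, _, by norm_num, by norm_num, by norm_num, a.h₂_eq_pt⟩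

theorem not_cornerOrMid_h₁ {a : PinTriangle} {c : ℝ} (hc : 0 < c) (ha : a.HasSize c) :
    ¬ a.CornerOrMid a.h₁ := by
  have e := @pt_inj a c hc ha
  rw [CornerOrMid, corners, h₁_eq_pt, m_eq_pt]
  simp only [Set.mem_insert_iff, Set.mem_singleton_iff]
  rw [r_eq_pt, s_eq_pt, l_eq_pt, e, e, e, e]
  norm_num

theorem not_cornerOrMid_h₂ {a : PinTriangle} {c : ℝ} (hc : 0 < c) (ha : a.HasSize c) :
    ¬ a.CornerOrMid a.h₂ := by
  have e := @pt_inj a c hc ha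
  rw [CornerOrMid, corners, h₂_eq_pt, m_eq_pt]
  simp only [Set.mem_insert_iff, Set.mem_singleton_iff]
  rw [r_eq_pt, s_eq_pt, l_eq_pt, e, e, e, e]
  norm_num

namespace IsPatch

variable {Q : Set PinTriangle} {c : ℝ} {a b : PinTriangle}

theorem f_notMem (hQ : IsPatch Q c) (hc : 0 < c) (ha : a ∈ Q) (hb : b ∈ Q) (hab : a ≠ b) :
    b.f ∉ a.carrier := fun h =>
  (disjoint_interior_carrier hc (hQ.hasSize a ha) (hQ.disjoint a ha b hb hab)).le_bot
    ⟨h, f_mem_interior hc (hQ.hasSize b hb)⟩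

/-- If the midpoint is not a corner of `a`, the shared side has relative length 2, so it is also the
long leg of `a`, with the same midpoint. -/
theorem cornerOrMid_m (hQ : IsPatch Q c) (hc : 0 < c) (ha : a ∈ Q) (hb : b ∈ Q) (hab : a ≠ b)
    (h : b.m ∈ a.carrier) : a.CornerOrMid b.m := by
  have e : b.m = b.r + ((1 / 2 : ℝ) : ℂ) * (b.l - b.r) := by simp [m]; ring
  have s5 := two_lt_sqrt_five
  rw [e] at h
  rcases corner_or_common_side hc (hQ.hasSize a ha) (hQ.hasSize b hb) (hQ.disjoint a ha b hb hab)
    (hQ.cornerOrMid a ha b hb) (hQ.cornerOrMid b hb a ha) (.inr (.inl ⟨rfl, rfl, rfl⟩))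
    (.inr ⟨rfl, rfl⟩) (by norm_num) (by norm_num) h with h | ⟨p, q, hS, h⟩
  · left; rwa [e]
  · right
    rcases hS with ⟨-, -, hL⟩ | ⟨hp, hq, -⟩ | ⟨-, -, hL⟩
    · linarith
    · rcases h with ⟨h1, h2⟩ | ⟨h1, h2⟩ <;> simp only [m, h1, h2, hp, hq]
      ring
    · linarith

/-- A corner of `a` cannot be at `b.h₁` or `b.h₂`, as the patch condition for `b` forbids it. So a
side is shared, and its length `√5` makes it the hypotenuse of both. -/
theorem common_hypotenuse_of_mem (hQ : IsPatch Q c) (hc : 0 < c) (ha : a ∈ Q) (hb : b ∈ Q)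
    (hab : a ≠ b) (h : b.h₁ ∈ a.carrier ∨ b.h₂ ∈ a.carrier) :
    (a.s = b.s ∧ a.l = b.l) ∨ (a.s = b.l ∧ a.l = b.s) := by
  have e₁ : b.h₁ = b.s + ((1 / 5 : ℝ) : ℂ) * (b.l - b.s) := by simp [h₁]; ring
  have e₂ : b.h₂ = b.s + ((3 / 5 : ℝ) : ℂ) * (b.l - b.s) := by simp [h₂]; ring
  have s5 := two_lt_sqrt_five
  have key : ∀ η : ℝ, 0 < η → η < 1 → ¬ b.CornerOrMid (b.s + η * (b.l - b.s)) →
      b.s + η * (b.l - b.s) ∈ b.carrier → b.s + η * (b.l - b.s) ∈ a.carrier →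
      (a.s = b.s ∧ a.l = b.l) ∨ (a.s = b.l ∧ a.l = b.s) := by
    intro η h0 h1 hn hm h
    rcases corner_or_common_side hc (hQ.hasSize a ha) (hQ.hasSize b hb)
      (hQ.disjoint a ha b hb hab) (hQ.cornerOrMid a ha b hb) (hQ.cornerOrMid b hb a ha)
      (.inr (.inr ⟨rfl, rfl, rfl⟩)) (.inl rfl) h0 h1 h with h | ⟨p, q, hS, h⟩
    · exact absurd (hQ.cornerOrMid b hb a ha _ h hm) hn
    · rcases hS with ⟨-, -, hL⟩ | ⟨-, -, hL⟩ | ⟨rfl, rfl, -⟩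
      · linarith
      · linarith
      · rcases h with ⟨h1, h2⟩ | ⟨h1, h2⟩
        · exact .inl ⟨h1.symm, h2.symm⟩
        · exact .inr ⟨h2.symm, h1.symm⟩
  rcases h with h | h
  · refine key (1 / 5) (by norm_num) (by norm_num) ?_ ?_ ?_ <;> rw [← e₁]
    exacts [not_cornerOrMid_h₁ hc (hQ.hasSize b hb), h₁_mem_carrier b, h]
  · refine key (3 / 5) (by norm_num) (by norm_num) ?_ ?_ ?_ <;> rw [← e₂]
    exacts [not_cornerOrMid_h₂ hc (hQ.hasSize b hb), h₂_mem_carrier b, h]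

theorem _root_.PinTriangle.mem_of_mem_corners_subdivide {b' : PinTriangle} {z : ℂ}
    (hb' : b' ∈ b.subdivide) (hz : z ∈ b'.corners) :
    z ∈ b.corners ∨ z = b.h₁ ∨ z = b.h₂ ∨ z = b.m ∨ z = b.f := by
  simp only [subdivide, Set.mem_insert_iff, Set.mem_singleton_iff] at hb'
  rcases hb' with rfl | rfl | rfl | rfl | rfl <;> rcases hz with rfl | rfl | rfl <;> simp [corners]

theorem _root_.PinTriangle.CornerOrMid.mem_nodes {z : ℂ} (h : a.CornerOrMid z) : z ∈ a.nodes := by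
  rcases h with (rfl | rfl | rfl) | rfl <;> simp [nodes]

/-- The corners of the tiles of the subdivided patch are nodes of each triangle containing them. -/
theorem mem_nodes (hQ : IsPatch Q c) (hc : 0 < c) (ha : a ∈ Q) (hb : b ∈ Q) {b' : PinTriangle}
    {z : ℂ} (hb' : b' ∈ b.subdivide) (hz : z ∈ b'.corners) (hza : z ∈ a.carrier) :
    z ∈ a.nodes := by
  have hz' := mem_of_mem_corners_subdivide hb' hz
  by_cases hab : a = b
  · subst hab
    rcases hz' with (rfl | rfl | rfl) | rfl | rfl | rfl | rfl <;> simp [nodes]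
  rcases hz' with h | rfl | rfl | rfl | rfl
  · exact (hQ.cornerOrMid a ha b hb z h hza).mem_nodes
  · rcases hQ.common_hypotenuse_of_mem hc ha hb hab (.inl hza) with ⟨h1, h2⟩ | ⟨h1, h2⟩
    · simp [nodes, h₁, h1, h2]
    · simp [nodes, h₁, h1, h2, add_comm]
  · rcases hQ.common_hypotenuse_of_mem hc ha hb hab (.inr hza) with ⟨h1, h2⟩ | ⟨h1, h2⟩
    · simp [nodes, h₂, h1, h2]
    · simp [nodes, h₂, h1, h2, add_comm]
  · exact (hQ.cornerOrMid_m hc ha hb hab hza).mem_nodes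
  · exact absurd hza (hQ.f_notMem hc ha hb hab)

/-- The nodes mediate: new corners lying on a triangle of `Q` are among its nodes, and its five
parts meet nodes only in permitted places. -/
theorem subdivide {c : ℝ} (hc : 0 < c) (hQ : IsPatch Q (√5 * c)) :
    IsPatch (⋃ a ∈ Q, a.subdivide) c := by
  have hc' : 0 < √5 * c := by positivity
  refine ⟨fun b hb => ?_, fun a' ha' b' hb' hab => ?_, fun a' ha' b' hb' z hz hza => ?_⟩
  · obtain ⟨a, ha, hb⟩ := Set.mem_iUnion₂.1 hb
    exact hasSize_of_mem_subdivide hc.le (hQ.hasSize a ha) hb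
  · obtain ⟨a, ha, ha'⟩ := Set.mem_iUnion₂.1 ha'
    obtain ⟨b, hb, hb'⟩ := Set.mem_iUnion₂.1 hb'
    by_cases h : a = b
    · subst h
      exact disjoint_of_mem_subdivide hc' (hQ.hasSize a ha) ha' hb' hab
    · exact (hQ.disjoint a ha b hb h).mono (interior_mono (carrier_subset_of_mem_subdivide ha'))
        (interior_mono (carrier_subset_of_mem_subdivide hb'))
  · obtain ⟨a, ha, ha'⟩ := Set.mem_iUnion₂.1 ha'
    obtain ⟨b, hb, hb'⟩ := Set.mem_iUnion₂.1 hb'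
    exact cornerOrMid_of_mem_nodes hc' (hQ.hasSize a ha) ha'
      (hQ.mem_nodes hc' ha hb hb' hz (carrier_subset_of_mem_subdivide ha' hza)) hza

end IsPatch

theorem isPatch_singleton {t : PinTriangle} {c : ℝ} (ht : t.HasSize c) : IsPatch {t} c := by
  refine ⟨?_, ?_, ?_⟩
  · rintro a rfl; exact ht
  · rintro a rfl b rfl h; exact absurd rfl h
  · rintro a rfl b rfl z hz -; exact .inl hz

/-- The definition isolates the first subdivision; refining patches needs the last one isolated. -/
theorem iterSubdivide_succ_eq (n : ℕ) (t : PinTriangle) :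
    t.iterSubdivide (n + 1) = ⋃ a ∈ t.iterSubdivide n, a.subdivide := by
  induction n generalizing t with
  | zero => simp [iterSubdivide]
  | succ n ih =>
    rw [iterSubdivide, iterSubdivide]
    simp only [ih]
    ext b
    simp only [Set.mem_iUnion, exists_prop]
    grind

theorem isPatch_iterSubdivide (n : ℕ) {t : PinTriangle} {c : ℝ} (hc : 0 < c)
    (ht : t.HasSize (√5 ^ n * c)) : IsPatch (t.iterSubdivide n) c := by
  induction n generalizing c with
  | zero => exact isPatch_singleton (by simpa using ht)
  | succ n ih =>
    rw [iterSubdivide_succ_eq]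
    exact (ih (by positivity) (by rwa [← mul_assoc, ← pow_succ])).subdivide hc

end PinTriangle

/-! ### Parity in `ℤ[i][1/5]`. -/

/-- The module `ℤ[i][1/5] u`. -/
def fifthLattice (u : ℂ) : AddSubgroup ℂ where
  carrier := {v | ∃ (N : ℕ) (x y : ℤ), 5 ^ N * v = (x + y * Complex.I) * u}
  zero_mem' := ⟨0, 0, 0, by simp⟩
  add_mem' := by
    rintro v w ⟨N, x, y, h⟩ ⟨M, x', y', h'⟩
    refine ⟨N + M, 5 ^ M * x + 5 ^ N * x', 5 ^ M * y + 5 ^ N * y', ?_⟩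
    push_cast
    rw [pow_add]
    linear_combination 5 ^ M * h + 5 ^ N * h'
  neg_mem' := by
    rintro v ⟨N, x, y, h⟩
    refine ⟨N, -x, -y, ?_⟩
    push_cast
    linear_combination -h

namespace fifthLattice

variable {u v w : ℂ}

theorem self_mem (u : ℂ) : u ∈ fifthLattice u := ⟨0, 1, 0, by simp⟩

theorem I_mul_mem (h : v ∈ fifthLattice u) : Complex.I * v ∈ fifthLattice u := by
  obtain ⟨N, x, y, h⟩ := h
  refine ⟨N, -y, x, ?_⟩
  push_cast
  linear_combination Complex.I * h + y * u * Complex.I_sq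

theorem div_five_mem (h : v ∈ fifthLattice u) : v / 5 ∈ fifthLattice u := by
  obtain ⟨N, x, y, h⟩ := h
  refine ⟨N + 1, x, y, ?_⟩
  rw [← h, pow_succ]
  ring

/-- `v / u` is not divisible by `1 + i` in `ℤ[i][1/5]`. -/
def IsOdd (u v : ℂ) : Prop := ∃ (N : ℕ) (x y : ℤ), 5 ^ N * v = (x + y * Complex.I) * u ∧ Odd (x + y)

theorem odd_five_pow (N : ℕ) : Odd ((5 : ℤ) ^ N) := Odd.pow (by decide)

theorem int_add_mul_I_eq_zero {x y : ℤ} (h : (x + y * Complex.I : ℂ) = 0) : x = 0 ∧ y = 0 := by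
  have h1 := congrArg Complex.re h
  have h2 := congrArg Complex.im h
  simp at h1 h2
  exact ⟨h1, h2⟩

/-- Denominators are powers of 5, hence odd, so parity does not depend on the chosen representation.
-/
theorem isOdd_iff (hu : u ≠ 0) {N : ℕ} {x y : ℤ} (h : 5 ^ N * v = (x + y * Complex.I) * u) :
    IsOdd u v ↔ Odd (x + y) := by
  refine ⟨?_, fun ho => ⟨N, x, y, h, ho⟩⟩
  rintro ⟨M, x', y', h', ho⟩
  have e : ((5 ^ N * x' - 5 ^ M * x : ℤ) + (5 ^ N * y' - 5 ^ M * y : ℤ) * Complex.I : ℂ) = 0 := by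
    apply mul_right_cancel₀ hu
    push_cast
    linear_combination 5 ^ M * h - 5 ^ N * h'
  obtain ⟨e₁, e₂⟩ := int_add_mul_I_eq_zero e
  have e₃ : 5 ^ M * (x + y) = 5 ^ N * (x' + y') := by linear_combination -e₁ - e₂
  have := (odd_five_pow N).mul ho
  rw [← e₃] at this
  exact (Int.odd_mul.1 this).2

/-- The parity of `X + Y` is that of `X ^ 2 + Y ^ 2`, which agrees with the squared distance up to
powers of 5. -/
theorem isOdd_iff_isOdd_iff_even (hv : v ∈ fifthLattice u) (hw : w ∈ fifthLattice u) {n q : ℕ}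
    (hu : ‖u‖ ^ 2 = 5 ^ n) (hq : ‖v - w‖ ^ 2 = q) : (IsOdd u v ↔ IsOdd u w) ↔ Even q := by
  have hu0 : u ≠ 0 := by
    rintro rfl
    rw [norm_zero] at hu
    have : (0 : ℝ) < 5 ^ n := by positivity
    simp at hu
    linarith
  obtain ⟨N, x, y, h⟩ := hv
  obtain ⟨M, x', y', h'⟩ := hw
  rw [isOdd_iff hu0 h, isOdd_iff hu0 h']
  set X : ℤ := 5 ^ M * x - 5 ^ N * x' with hX
  set Y : ℤ := 5 ^ M * y - 5 ^ N * y' with hY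
  have e : 5 ^ (N + M) * (v - w) = (X + Y * Complex.I) * u := by
    rw [hX, hY, pow_add]
    push_cast
    linear_combination 5 ^ M * h - 5 ^ N * h'
  have hn : ‖(X + Y * Complex.I : ℂ)‖ ^ 2 = X ^ 2 + Y ^ 2 := by
    rw [← Complex.normSq_eq_norm_sq]
    have := Complex.normSq_add_mul_I X Y
    push_cast at this
    exact this
  have e' := congrArg (fun z : ℂ => ‖z‖ ^ 2) e
  simp only [norm_mul, mul_pow, hn, hu, hq, norm_pow, Complex.norm_ofNat] at e'
  have e'' : (5 ^ (N + M)) ^ 2 * (q : ℤ) = (X ^ 2 + Y ^ 2) * 5 ^ n := by exact_mod_cast e'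
  have p := congrArg Even e''
  have d₁ := odd_five_pow N
  have d₂ := odd_five_pow M
  have d₃ := odd_five_pow n
  have d₄ := odd_five_pow (N + M)
  rw [← Int.not_even_iff_odd] at d₁ d₂ d₃ d₄
  simp only [Int.even_mul, Int.even_pow, Int.even_add, d₃, d₄, Int.even_coe_nat] at p
  have pX : Even X ↔ (Even x ↔ Even x') := by
    rw [hX]; simp only [Int.even_sub, Int.even_mul, d₁, d₂, false_or]
  have pY : Even Y ↔ (Even y ↔ Even y') := by
    rw [hY]; simp only [Int.even_sub, Int.even_mul, d₁, d₂, false_or]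
  rw [pX, pY] at p
  rw [← Int.not_even_iff_odd, ← Int.not_even_iff_odd, Int.even_add, Int.even_add]
  simp at p
  grind

end fifthLattice

/-! ### Lattice positions of the vertices and the third colour class. -/

namespace PinTriangle

/-- Halving the long leg costs no denominator 2, since `a.m - a.r` is `±i` times the short leg; the
other cut points need only fifths. -/
theorem corners_subdivide_mem_fifthLattice {a b : PinTriangle} {c : ℝ} {o u : ℂ} (hc : 0 < c)
    (ha : a.HasSize c) (hb : b ∈ a.subdivide) (h : ∀ z ∈ a.corners, z - o ∈ fifthLattice u) :
    ∀ z ∈ b.corners, z - o ∈ fifthLattice u := by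
  have hr := h a.r (by simp [corners])
  have hs := h a.s (by simp [corners])
  have hl := h a.l (by simp [corners])
  have hS : a.s - a.r ∈ fifthLattice u := by
    have := sub_mem hs hr; rwa [sub_sub_sub_cancel_right] at this
  have hL : a.l - a.r ∈ fifthLattice u := by
    have := sub_mem hl hr; rwa [sub_sub_sub_cancel_right] at this
  have hM : a.m - a.r ∈ fifthLattice u := by
    rcases l_sub_r hc ha with e | e
    · have : a.m - a.r = Complex.I * (a.s - a.r) := by simp only [m]; linear_combination e / 2
      rw [this]
      exact fifthLattice.I_mul_mem hS
    · have : a.m - a.r = -(Complex.I * (a.s - a.r)) := by simp only [m]; linear_combination e / 2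
      rw [this]
      exact neg_mem (fifthLattice.I_mul_mem hS)
  intro z hz
  rcases mem_of_mem_corners_subdivide hb hz with hz | rfl | rfl | rfl | rfl
  · exact h z hz
  · have : a.h₁ - o = (a.r - o) + (4 • (a.s - a.r) + (a.l - a.r)) / 5 := by simp [h₁]; ring
    rw [this]
    exact add_mem hr (fifthLattice.div_five_mem (add_mem (nsmul_mem hS 4) hL))
  · have : a.h₂ - o = (a.r - o) + (2 • (a.s - a.r) + 3 • (a.l - a.r)) / 5 := by simp [h₂]; ring
    rw [this]
    exact add_mem hr (fifthLattice.div_five_mem (add_mem (nsmul_mem hS 2) (nsmul_mem hL 3)))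
  · have : a.m - o = (a.r - o) + (a.m - a.r) := by ring
    rw [this]
    exact add_mem hr hM
  · have : a.f - o = (a.r - o) + (2 • (a.s - a.r) + (a.m - a.r)) / 5 := by simp [f, m, h₁]; ring
    rw [this]
    exact add_mem hr (fifthLattice.div_five_mem (add_mem (nsmul_mem hS 2) hM))

theorem corners_iterSubdivide_mem_fifthLattice (n : ℕ) {t : PinTriangle} {c : ℝ} (hc : 0 < c)
    (ht : t.HasSize (√5 ^ n * c)) {b : PinTriangle} (hb : b ∈ t.iterSubdivide n) :
    ∀ z ∈ b.corners, z - t.r ∈ fifthLattice (t.s - t.r) := by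
  induction n generalizing c b with
  | zero =>
    obtain rfl : b = t := hb
    have hc' : 0 < √5 ^ 0 * c := by positivity
    have hS := fifthLattice.self_mem (b.s - b.r)
    rintro z (rfl | rfl | rfl)
    · rw [sub_self]; exact zero_mem _
    · exact hS
    · have h2 : 2 • (Complex.I * (b.s - b.r)) ∈ fifthLattice (b.s - b.r) :=
        nsmul_mem (fifthLattice.I_mul_mem hS) 2
      have e : 2 • (Complex.I * (b.s - b.r)) = 2 * Complex.I * (b.s - b.r) := by simp; ring
      rw [e] at h2
      rcases l_sub_r hc' ht with e | e <;> rw [e]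
      · exact h2
      · exact neg_mem h2
  | succ n ih =>
    rw [iterSubdivide_succ_eq] at hb
    obtain ⟨a, ha, hb⟩ := Set.mem_iUnion₂.1 hb
    have ht' : t.HasSize (√5 ^ n * (√5 * c)) := by rwa [← mul_assoc, ← pow_succ]
    have hc' : 0 < √5 * c := by positivity
    exact corners_subdivide_mem_fifthLattice hc'
      ((isPatch_iterSubdivide n hc' ht').hasSize a ha) hb (ih hc' ht' ha)

/-- The first three tiles of the subdivision touch `a.f`, the last two touch `a.h₂`. -/
theorem not_cornerOrMid_f_and_h₂ {a b : PinTriangle} {c : ℝ} (hc : 0 < c) (ha : a.HasSize c)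
    (hb : b ∈ a.subdivide) : ¬ (b.CornerOrMid a.f ∧ b.CornerOrMid a.h₂) := by
  have e := @pt_inj a c hc ha
  simp only [subdivide, Set.mem_insert_iff, Set.mem_singleton_iff] at hb
  simp only [h₁_eq_pt, h₂_eq_pt, m_eq_pt, f_eq_pt] at hb ⊢
  rw [r_eq_pt, s_eq_pt, l_eq_pt] at hb
  rcases hb with hb | hb | hb | hb | hb <;> rw [cornerOrMid_pt_iff hb,
    cornerOrMid_pt_iff hb] <;> simp only [e] <;> norm_num

theorem nodes_ne {a : PinTriangle} {c : ℝ} (hc : 0 < c) (ha : a.HasSize c) :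
    a.m ≠ a.f ∧ a.m ≠ a.h₂ ∧ a.h₁ ≠ a.f ∧ a.h₁ ≠ a.h₂ ∧ a.l ≠ a.f ∧ a.l ≠ a.h₂ := by
  have e := @pt_inj a c hc ha
  rw [l_eq_pt]
  simp only [h₁_eq_pt, h₂_eq_pt, m_eq_pt, f_eq_pt, ne_eq, e]
  norm_num

/-- The vertices of the subdivision of `Q` which receive the third colour. -/
def thirdClass (Q : Set PinTriangle) : Set ℂ :=
  {z | ∃ a ∈ Q, z = a.f ∨ z = a.h₂ ∧ ∀ b ∈ Q, ¬ (b.s = a.l ∧ b.l = a.s)}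

namespace IsPatch

variable {Q : Set PinTriangle} {c : ℝ} {a b : PinTriangle}

/-- The point `b.f` is interior to `b`. If `b.h₂` lies on another triangle `a`, the hypotenuse is
shared; the definition of the class excludes the reversed direction, and in the other case `a.h₂ =
b.h₂`. -/
theorem eq_of_mem_thirdClass (hQ : IsPatch Q c) (hc : 0 < c) {z : ℂ} (hz : z ∈ thirdClass Q)
    (ha : a ∈ Q) (hza : z ∈ a.carrier) : z = a.f ∨ z = a.h₂ := by
  obtain ⟨b, hb, hz⟩ := hz
  by_cases hab : a = b
  · subst hab
    exact hz.imp_right And.left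
  rcases hz with rfl | ⟨rfl, hn⟩
  · exact absurd hza (hQ.f_notMem hc ha hb hab)
  · rcases hQ.common_hypotenuse_of_mem hc ha hb hab (.inr hza) with ⟨h1, h2⟩ | h
    · right; simp [h₂, h1, h2]
    · exact absurd h (hn a ha)

theorem not_mem_thirdClass_and (hQ : IsPatch Q c) (hc : 0 < c) (ha : a ∈ Q)
    (hb : b ∈ a.subdivide) {v w : ℂ} (hvw : v ≠ w) (hv : b.CornerOrMid v) (hw : b.CornerOrMid w)
    (hvb : v ∈ b.carrier) (hwb : w ∈ b.carrier) : ¬ (v ∈ thirdClass Q ∧ w ∈ thirdClass Q) := by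
  rintro ⟨h1, h2⟩
  have hn := not_cornerOrMid_f_and_h₂ hc (hQ.hasSize a ha) hb
  have hs := carrier_subset_of_mem_subdivide hb
  rcases hQ.eq_of_mem_thirdClass hc h1 ha (hs hvb) with rfl | rfl <;>
  rcases hQ.eq_of_mem_thirdClass hc h2 ha (hs hwb) with rfl | rfl
  · exact hvw rfl
  · exact hn ⟨hv, hw⟩
  · exact hn ⟨hw, hv⟩
  · exact hvw rfl

/-- The long leg from `h₁` to `r` is always divided, by `f`. The tiles with right angle at `f` share
the leg from `f` to `m`. The two legs starting at `h₂` lie on the hypotenuse; a neighbour with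
reversed hypotenuse would put its `h₂` and `h₁` at their midpoints, so if one is undivided there is
no such neighbour. -/
theorem mem_thirdClass_of_m_notMem (hQ : IsPatch Q c) (hc : 0 < c) (ha : a ∈ Q)
    (hb : b ∈ a.subdivide) (hm : b.m ∉ tilingVertices (⋃ a ∈ Q, a.subdivide)) :
    b.r ∈ thirdClass Q ∧ b.l ∉ thirdClass Q := by
  obtain ⟨n1, n2, n3, n4, n5, n6⟩ := nodes_ne hc (hQ.hasSize a ha)
  have hr : b.r ∈ b.corners := by simp [corners]
  have hl : b.l ∈ a.carrier := carrier_subset_of_mem_subdivide hb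
    (corner_mem_carrier (by simp [corners]))
  have vert : ∀ a' ∈ Q, ∀ b' ∈ a'.subdivide, ∀ z ∈ b'.corners, b.m ≠ z := by
    rintro a' ha' b' hb' z hz rfl
    exact hm (Set.mem_biUnion (Set.mem_biUnion ha' hb') hz)
  refine ⟨?_, fun h => ?_⟩
  · have partner : b.r = a.h₂ → (∀ a' ∈ Q, a'.s = a.l → a'.l = a.s → b.m = a'.h₁ ∨ b.m = a'.h₂) →
        b.r ∈ thirdClass Q := by
      refine fun h hp => ⟨a, ha, .inr ⟨h, fun a' ha' ⟨h1, h2⟩ => ?_⟩⟩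
      rcases hp a' ha' h1 h2 with h | h
      · exact vert a' ha' ⟨a'.h₁, a'.s, a'.r⟩ (by simp [PinTriangle.subdivide]) _ (by simp [corners]) h
      · exact vert a' ha' ⟨a'.h₂, a'.m, a'.l⟩ (by simp [PinTriangle.subdivide]) _ (by simp [corners]) h
    simp only [PinTriangle.subdivide, Set.mem_insert_iff, Set.mem_singleton_iff] at hb
    rcases hb with rfl | rfl | rfl | rfl | rfl
    · refine absurd ?_ (vert a ha ⟨a.f, a.r, a.m⟩ (by simp [PinTriangle.subdivide]) a.f (by simp [corners]))
      simp [m, f, add_comm]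
    · exact ⟨a, ha, .inl rfl⟩
    · exact ⟨a, ha, .inl rfl⟩
    · refine partner rfl fun a' ha' h1 h2 => .inr ?_
      simp only [m, h₁, h₂, h1, h2]; ring
    · refine partner rfl fun a' ha' h1 h2 => .inl ?_
      simp only [m, h₁, h₂, h1, h2]; ring
  · have := hQ.eq_of_mem_thirdClass hc h ha hl
    simp only [PinTriangle.subdivide, Set.mem_insert_iff, Set.mem_singleton_iff] at hb
    rcases hb with rfl | rfl | rfl | rfl | rfl
    · refine absurd ?_ (vert a ha ⟨a.f, a.r, a.m⟩ (by simp [PinTriangle.subdivide]) a.f (by simp [corners]))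
      simp [m, f, add_comm]
    all_goals simp_all

end IsPatch

/-! ### Edge lengths and the colouring of a supertile. -/

theorem exists_isSide_of_mem_sides {b : PinTriangle} {σ : Set ℂ} (h : σ ∈ b.sides) :
    ∃ p q L, b.IsSide p q L ∧ σ = segment ℝ p q := by
  rcases h with rfl | rfl | rfl
  · exact ⟨_, _, _, .inl ⟨rfl, rfl, rfl⟩, rfl⟩
  · exact ⟨_, _, _, .inr (.inl ⟨rfl, rfl, rfl⟩), rfl⟩
  · exact ⟨_, _, _, .inr (.inr ⟨rfl, rfl, rfl⟩), rfl⟩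

theorem segment_subset_carrier_of_mem_sides {b : PinTriangle} {σ : Set ℂ} (h : σ ∈ b.sides) :
    σ ⊆ b.carrier := by
  obtain ⟨p, q, L, hS, rfl⟩ := exists_isSide_of_mem_sides h
  exact (convex_carrier b).segment_subset (corner_mem_carrier hS.corners.1)
    (corner_mem_carrier hS.corners.2)

theorem m_mem_openSegment (b : PinTriangle) : b.m ∈ openSegment ℝ b.r b.l :=
  ⟨1 / 2, 1 / 2, by norm_num, by norm_num, by norm_num, by simp [m]; ring⟩

theorem eq_add_of_mem_segment {p q z : ℂ} (h : z ∈ segment ℝ p q) :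
    ∃ t : ℝ, z = p + t * (q - p) := by
  rw [segment_eq_image'] at h
  obtain ⟨t, -, rfl⟩ := h
  exact ⟨t, by simp⟩

/-- The possible distances of two vertices on a side of a tile. -/
theorem norm_sub_sq_of_mem_side {b : PinTriangle} (hb : b.HasSize 1) {σ : Set ℂ} (hσ : σ ∈ b.sides)
    {v w : ℂ} (hv : v ∈ σ) (hw : w ∈ σ) (hvw : v ≠ w) (hv' : b.CornerOrMid v)
    (hw' : b.CornerOrMid w) : (∃ q : ℕ, Odd q ∧ ‖v - w‖ ^ 2 = q) ∨
      (v = b.r ∧ w = b.l) ∨ (v = b.l ∧ w = b.r) := by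
  obtain ⟨p, q, L, hS, rfl⟩ := exists_isSide_of_mem_sides hσ
  obtain ⟨x, rfl⟩ := eq_add_of_mem_segment hv
  obtain ⟨y, rfl⟩ := eq_add_of_mem_segment hw
  have hx := hS.cornerOrMid one_pos hb hv'
  have hy := hS.cornerOrMid one_pos hb hw'
  have hxy : x ≠ y := by rintro rfl; exact hvw rfl
  have hd := hS.dist_eq hb
  have hn : ‖p + x * (q - p) - (p + y * (q - p))‖ ^ 2 = ((x - y) * L) ^ 2 := by
    have : p + x * (q - p) - (p + y * (q - p)) = ((x - y : ℝ) : ℂ) * (q - p) := by push_cast; ring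
    rw [this, norm_mul, Complex.norm_real, mul_pow, Real.norm_eq_abs, sq_abs, ← dist_eq_norm,
      dist_comm, hd, mul_one, mul_pow]
  rw [hn]
  clear hn hv hw hv' hw' hvw hd hσ
  have e5 : √5 ^ 2 = (5 : ℝ) := Real.sq_sqrt (by norm_num)
  have s5 := two_lt_sqrt_five
  rcases hS with ⟨rfl, rfl, rfl⟩ | ⟨rfl, rfl, rfl⟩ | ⟨rfl, rfl, rfl⟩
  · left
    refine ⟨1, odd_one, ?_⟩
    rcases hx with rfl | rfl | hx <;> rcases hy with rfl | rfl | hy <;> norm_num at *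
  · rcases hx with rfl | rfl | ⟨-, rfl⟩ <;> rcases hy with rfl | rfl | ⟨-, rfl⟩ <;>
      first
      | exact absurd rfl hxy
      | (right; simp; done)
      | (left; exact ⟨1, odd_one, by norm_num⟩)
  · left
    refine ⟨5, by decide, ?_⟩
    rcases hx with rfl | rfl | ⟨hx, -⟩ <;> rcases hy with rfl | rfl | ⟨hy, -⟩ <;>
      first
      | exact absurd rfl hxy
      | (exfalso; linarith)
      | (rw [mul_pow, e5]; norm_num)

open Classical in
/-- A colouring of the vertices of the supertile `t.iterSubdivide (n + 1)`. -/
noncomputable def supertileColor (n : ℕ) (t : PinTriangle) (z : ℂ) : Fin 3 :=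
  if z ∈ thirdClass (t.iterSubdivide n) then 2
  else if fifthLattice.IsOdd (t.s - t.r) (z - t.r) then 1 else 0

theorem supertileColor_ne (n : ℕ) {t : PinTriangle} (ht : t.HasSize (√5 ^ (n + 1)))
    {b : PinTriangle} (hb : b ∈ t.iterSubdivide (n + 1)) {σ : Set ℂ} (hσ : σ ∈ b.sides) {v w : ℂ}
    (hv : v ∈ σ) (hw : w ∈ σ) (hvw : v ≠ w) (hvP : v ∈ tilingVertices (t.iterSubdivide (n + 1)))
    (hwP : w ∈ tilingVertices (t.iterSubdivide (n + 1)))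
    (h : Disjoint (openSegment ℝ v w) (tilingVertices (t.iterSubdivide (n + 1)))) :
    supertileColor n t v ≠ supertileColor n t w := by
  have s5 : 0 < √5 := by positivity
  have hQ := isPatch_iterSubdivide n (t := t) s5 (by rwa [← pow_succ])
  have hP := isPatch_iterSubdivide (n + 1) (t := t) one_pos (by rwa [mul_one])
  obtain ⟨bv, hbv, hv'⟩ := Set.mem_iUnion₂.1 hvP
  obtain ⟨bw, hbw, hw'⟩ := Set.mem_iUnion₂.1 hwP
  have hvb := segment_subset_carrier_of_mem_sides hσ hv
  have hwb := segment_subset_carrier_of_mem_sides hσ hw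
  have cv := hP.cornerOrMid b hb bv hbv v hv' hvb
  have cw := hP.cornerOrMid b hb bw hbw w hw' hwb
  have hb' := hb
  rw [iterSubdivide_succ_eq] at hb'
  obtain ⟨a, ha, hba⟩ := Set.mem_iUnion₂.1 hb'
  rcases norm_sub_sq_of_mem_side (hP.hasSize b hb) hσ hv hw hvw cv cw with
    ⟨q, hq, hn⟩ | hrl
  · have h3 := hQ.not_mem_thirdClass_and s5 ha hba hvw cv cw hvb hwb
    have hu : ‖t.s - t.r‖ ^ 2 = 5 ^ (n + 1) := by
      rw [← dist_eq_norm, dist_comm, ht.1, ← pow_mul, mul_comm, pow_mul, Real.sq_sqrt (by norm_num)]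
    have ht' : t.HasSize (√5 ^ (n + 1) * 1) := by rwa [mul_one]
    have hpar := fifthLattice.isOdd_iff_isOdd_iff_even (q := q)
      (corners_iterSubdivide_mem_fifthLattice _ one_pos ht' hbv v hv')
      (corners_iterSubdivide_mem_fifthLattice _ one_pos ht' hbw w hw') hu
      (by rwa [sub_sub_sub_cancel_right])
    have hne := mt hpar.1 (Nat.not_even_iff_odd.2 hq)
    clear hpar hq
    unfold supertileColor
    split_ifs <;> simp_all
  -- The edge is a whole long leg, so its midpoint is not a vertex and exactly one end has the third
  -- colour.
  · have hm : b.m ∉ tilingVertices (⋃ a ∈ t.iterSubdivide n, a.subdivide) := by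
      rw [← iterSubdivide_succ_eq]
      refine fun hm => Set.disjoint_left.1 h ?_ hm
      rcases hrl with ⟨rfl, rfl⟩ | ⟨rfl, rfl⟩
      · exact m_mem_openSegment b
      · rw [openSegment_symm]; exact m_mem_openSegment b
    obtain ⟨h1, h2⟩ := hQ.mem_thirdClass_of_m_notMem s5 ha hba hm
    unfold supertileColor
    rcases hrl with ⟨rfl, rfl⟩ | ⟨rfl, rfl⟩ <;> rw [if_pos h1, if_neg h2] <;> split_ifs <;> decide

/-! ### From supertiles to tilings of the plane. -/

theorem ball_subset_interior {a : PinTriangle} (ha : a.HasSize 1) :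
    Metric.ball (a.pt (1 / 3) (1 / 4)) (1 / 10) ⊆ interior a.carrier := by
  have u0 := s_sub_r_ne_zero one_pos ha
  have u1 : ‖a.s - a.r‖ = 1 := by rw [← dist_eq_norm, dist_comm]; exact ha.1
  obtain ⟨ε, hε, e⟩ : ∃ ε : ℝ, (ε = 1 ∨ ε = -1) ∧
      a.l - a.r = 2 * ε * Complex.I * (a.s - a.r) := by
    rcases l_sub_r one_pos ha with e | e
    · exact ⟨1, .inl rfl, by rw [e]; simp⟩
    · exact ⟨-1, .inr rfl, by rw [e]; simp⟩
  intro z hz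
  rw [mem_ball_iff_norm] at hz
  set w := (z - a.pt (1 / 3) (1 / 4)) / (a.s - a.r) with hw
  have nw : ‖w‖ < 1 / 10 := by rw [hw, norm_div, u1, div_one]; exact hz
  have re := abs_lt.1 ((Complex.abs_re_le_norm w).trans_lt nw)
  have im := abs_lt.1 ((Complex.abs_im_le_norm w).trans_lt nw)
  have hz' : z = a.pt (1 / 3 + w.re) (1 / 4 + ε * w.im / 2) := by
    have h1 : z = a.pt (1 / 3) (1 / 4) + w * (a.s - a.r) := by
      rw [hw, div_mul_cancel₀ _ u0]; ring
    rw [h1]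
    simp only [pt, e]
    conv_lhs => rw [← Complex.re_add_im w]
    push_cast
    have : (ε : ℂ) ^ 2 = 1 := by
      rcases hε with rfl | rfl <;> norm_num
    linear_combination (-w.im * Complex.I * (a.s - a.r)) * this
  rw [hz']
  rcases hε with rfl | rfl <;>
    exact pt_mem_interior one_pos ha (by linarith) (by linarith) (by linarith)

theorem dist_le_of_mem_carrier {a : PinTriangle} {c : ℝ} (ha : a.HasSize c) {z w : ℂ}
    (hz : z ∈ a.carrier) (hw : w ∈ a.carrier) : dist z w ≤ 4 * c := by
  have hc : 0 ≤ c := ha.1 ▸ dist_nonneg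
  have h : a.carrier ⊆ Metric.closedBall a.r (2 * c) := by
    refine convexHull_min ?_ (convex_closedBall _ _)
    rintro p (rfl | rfl | rfl)
    · simpa using hc
    · rw [Metric.mem_closedBall, dist_comm, ha.1]; linarith
    · rw [Metric.mem_closedBall, dist_comm, ha.2.1]
  have h1 := Metric.mem_closedBall.1 (h hz)
  have h2 := Metric.mem_closedBall.1 (h hw)
  linarith [dist_triangle_right z w a.r]

/-- Every tile belongs to a supertile of level one. -/
theorem exists_mem_subdivide_of_hasSize {t : PinTriangle} {c : ℝ} (hc : 0 ≤ c)
    (ht : t.HasSize c) : ∃ t' : PinTriangle, t'.HasSize (√5 * c) ∧ t ∈ t'.subdivide := by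
  have e5 : √5 ^ 2 = (5 : ℝ) := Real.sq_sqrt (by norm_num)
  -- Obtained by solving for `t` to be the fifth tile: `t'.h₂ = t.r`, `t'.m = t.s`, `t'.l = t.l`.
  refine ⟨⟨2 * t.s - t.l, (5 * t.r - 3 * t.l) / 2, t.l⟩, ?_, ?_⟩
  · rw [hasSize_iff hc] at ht
    obtain ⟨h1, h2, h3⟩ := ht
    rw [hasSize_iff (by positivity), mul_pow, e5]
    simp
    refine ⟨?_, ?_, ?_⟩ <;> ring_nf at h1 h2 h3 ⊢ <;> linarith
  · have : t = ⟨h₂ ⟨2 * t.s - t.l, (5 * t.r - 3 * t.l) / 2, t.l⟩,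
        m ⟨2 * t.s - t.l, (5 * t.r - 3 * t.l) / 2, t.l⟩, t.l⟩ := by
      ext <;> simp [h₂, m]
      ring
    simp only [subdivide, Set.mem_insert_iff, Set.mem_singleton_iff]
    exact .inr (.inr (.inr (.inr this)))

end PinTriangle

namespace IsPinwheelTiling

open PinTriangle

variable {T : Set PinTriangle}

/-- A volume count: each tile contains a disc of radius `1 / 10`, these discs are disjoint, and all
lie in a bounded region. -/
theorem finite_meeting (hT : IsPinwheelTiling T) (ρ : ℝ) :
    {t ∈ T | (t.carrier ∩ Metric.ball 0 ρ).Nonempty}.Finite := by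
  set S := {t ∈ T | (t.carrier ∩ Metric.ball 0 ρ).Nonempty}
  let B : S → Set ℂ := fun t => Metric.ball (t.1.pt (1 / 3) (1 / 4)) (1 / 10)
  have hB : ∀ t : S, B t ⊆ interior t.1.carrier := fun t =>
    ball_subset_interior (hT.hasSize t.1 t.2.1)
  have vol : ∀ t : S, MeasureTheory.volume (B t) =
      MeasureTheory.volume (Metric.ball (0 : ℂ) (1 / 10)) := fun t =>
    MeasureTheory.Measure.addHaar_ball_center _ _ _
  have hsub : (⋃ t, B t) ⊆ Metric.ball 0 (ρ + 4) := by
    refine Set.iUnion_subset fun t z hz => ?_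
    obtain ⟨y, hy, hyρ⟩ := t.2.2
    have := dist_le_of_mem_carrier (hT.hasSize t.1 t.2.1) (interior_subset (hB t hz)) hy
    rw [Metric.mem_ball] at hyρ ⊢
    linarith [dist_triangle z y 0]
  have hfin := MeasureTheory.Measure.finite_const_le_meas_of_disjoint_iUnion MeasureTheory.volume
    (Metric.measure_ball_pos MeasureTheory.volume (0 : ℂ) (by norm_num : (0 : ℝ) < 1 / 10))
    (As := B) (fun t => Metric.isOpen_ball.measurableSet)
    (fun t t' h => (hT.disjoint_interior t.1 t.2.1 t'.1 t'.2.1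
      (fun h' => h (Subtype.ext h'))).mono (hB t) (hB t'))
    ((MeasureTheory.measure_mono hsub).trans_lt MeasureTheory.measure_ball_lt_top).ne
  have : {t : S | MeasureTheory.volume (Metric.ball (0 : ℂ) (1 / 10)) ≤
      MeasureTheory.volume (B t)} = Set.univ :=
    Set.eq_univ_of_forall fun t => (vol t).ge
  rw [this, Set.finite_univ_iff] at hfin
  exact Set.toFinite S

/-- In every disc the tiling agrees with a supertile. -/
theorem exists_supertile (hT : IsPinwheelTiling T) (ρ : ℝ) :
    ∃ (n : ℕ) (t : PinTriangle), t.HasSize (√5 ^ (n + 1)) ∧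
      ∀ b : PinTriangle, (b.carrier ∩ Metric.ball 0 ρ).Nonempty →
        (b ∈ T ↔ b ∈ t.iterSubdivide (n + 1)) := by
  obtain ⟨n, t, ht, hsub⟩ : ∃ (n : ℕ) (t : PinTriangle), t.HasSize (√5 ^ (n + 1)) ∧
      {t ∈ T | (t.carrier ∩ Metric.ball 0 ρ).Nonempty} ⊆ t.iterSubdivide (n + 1) := by
    obtain ⟨n, P, ⟨t, ht, rfl⟩, hP⟩ := hT.patches _ (Set.sep_subset _ _) (hT.finite_meeting ρ)
    -- The supertile may have level 0, while the colouring needs a last subdivision, so the level is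
    -- raised by one.
    obtain ⟨t', ht', htt'⟩ := exists_mem_subdivide_of_hasSize (by positivity) ht
    exact ⟨n, t', by rwa [pow_succ'], hP.trans (Set.subset_biUnion_of_mem
      (u := fun t : PinTriangle => t.iterSubdivide n) htt')⟩
  have hP := isPatch_iterSubdivide (n + 1) (t := t) one_pos (by rwa [mul_one])
  refine ⟨n, t, ht, fun b hb => ⟨fun h => hsub ⟨h, hb⟩, fun h => ?_⟩⟩
  obtain ⟨y, hy, hyρ⟩ := hb
  -- An interior point `z` of `b` in the disc is covered by a tile of `T`. That tile also belongs to
  -- the supertile, where tiles do not overlap, so it is `b`.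
  obtain ⟨z, hzρ, hz⟩ := mem_closure_iff.1
    (carrier_subset_closure_interior one_pos (hP.hasSize b h) hy) _ Metric.isOpen_ball hyρ
  obtain ⟨b', hb', hzb'⟩ := Set.mem_iUnion₂.1 (hT.covers.symm ▸ Set.mem_univ z)
  by_cases hbb' : b' = b
  · rwa [← hbb']
  · have hb'P := hsub ⟨hb', z, hzb', hzρ⟩
    exact absurd hz (Set.disjoint_left.1 (disjoint_interior_carrier one_pos (hP.hasSize b' hb'P)
      (hP.disjoint b' hb'P b h hbb')) hzb')

theorem mem_tilingVertices_iff {P : Set PinTriangle} {ρ : ℝ} (h : ∀ b : PinTriangle,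
    (b.carrier ∩ Metric.ball 0 ρ).Nonempty → (b ∈ T ↔ b ∈ P)) {z : ℂ} (hz : z ∈ Metric.ball 0 ρ) :
    z ∈ tilingVertices T ↔ z ∈ tilingVertices P := by
  simp only [tilingVertices, Set.mem_iUnion, exists_prop]
  constructor
  · rintro ⟨b, hb, hzb⟩
    exact ⟨b, (h b ⟨z, corner_mem_carrier hzb, hz⟩).1 hb, hzb⟩
  · rintro ⟨b, hb, hzb⟩
    exact ⟨b, (h b ⟨z, corner_mem_carrier hzb, hz⟩).2 hb, hzb⟩

theorem colorable (hT : IsPinwheelTiling T) : (tilingGraph T).Colorable 3 := by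
  -- De Bruijn–Erdős compactness: it suffices to colour finite subgraphs.
  refine SimpleGraph.nonempty_hom_of_forall_finite_subgraph_hom fun G hG => ?_
  have hρ : ∃ ρ : ℝ, ∀ v ∈ G.verts, (v : ℂ) ∈ Metric.ball (0 : ℂ) ρ := by
    obtain ⟨ρ, h⟩ := (hG.image ((↑) : tilingVertices T → ℂ)).isBounded.subset_ball 0
    exact ⟨ρ, fun v hv => h (Set.mem_image_of_mem _ hv)⟩
  choose ρ hρ using hρ
  choose n t ht h using hT.exists_supertile ρ
  refine ⟨fun v => supertileColor n t v.1, fun {v w} hvw => ?_⟩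
  obtain ⟨hne, ⟨b, hb, σ, hσ, hv, hw⟩, hd⟩ := G.adj_sub hvw
  have hvρ := hρ _ v.2
  have hwρ := hρ _ w.2
  refine supertileColor_ne n ht
    ((h b ⟨_, segment_subset_carrier_of_mem_sides hσ hv, hvρ⟩).1 hb) hσ hv hw
    (fun e => hne (Subtype.ext e)) ((mem_tilingVertices_iff h hvρ).1 v.1.2)
    ((mem_tilingVertices_iff h hwρ).1 w.1.2) (Set.disjoint_left.2 fun z hz hzP => ?_)
  -- By convexity the whole edge stays in the disc, so a vertex of the supertile on it would be a
  -- vertex of `T`.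
  have hzρ := (convex_ball (0 : ℂ) ρ).openSegment_subset hvρ hwρ hz
  exact Set.disjoint_left.1 hd hz ((mem_tilingVertices_iff h hzρ).2 hzP)

/-! ### The lower bound. -/

/-- Every pinwheel tiling contains a supertile of level one, together with its neighbourhood. -/
theorem exists_level_one (hT : IsPinwheelTiling T) : ∃ a : PinTriangle, a.HasSize √5 ∧
    a.subdivide ⊆ T ∧ ∀ z ∈ tilingVertices T, z ∈ a.carrier → z ∈ a.nodes := by
  -- The level-one triangle around the origin has diameter at most `4 * √5 < 12`, so it lies in this
  -- disc.
  obtain ⟨n, t, ht, h⟩ := hT.exists_supertile 20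
  have s5 : 0 < √5 := by positivity
  have s5' : √5 < 3 := (Real.sqrt_lt' (by norm_num)).2 (by norm_num)
  have hQ := isPatch_iterSubdivide n (t := t) s5 (by rwa [← pow_succ])
  obtain ⟨b, hb, h0⟩ := Set.mem_iUnion₂.1 (hT.covers.symm ▸ Set.mem_univ (0 : ℂ))
  have hbP := (h b ⟨0, h0, by simp⟩).1 hb
  rw [iterSubdivide_succ_eq] at hbP h
  obtain ⟨a, ha, hba⟩ := Set.mem_iUnion₂.1 hbP
  have hball : a.carrier ⊆ Metric.ball 0 20 := fun z hz => by
    have := dist_le_of_mem_carrier (hQ.hasSize a ha) hz (carrier_subset_of_mem_subdivide hba h0)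
    rw [Metric.mem_ball]
    linarith
  refine ⟨a, hQ.hasSize a ha, fun b' hb' => ?_, fun z hz hza => ?_⟩
  · have hr : b'.r ∈ b'.carrier := corner_mem_carrier (by simp [corners])
    exact (h b' ⟨_, hr, hball (carrier_subset_of_mem_subdivide hb' hr)⟩).2
      (Set.mem_biUnion ha hb')
  · obtain ⟨b', hb', hz'⟩ := Set.mem_iUnion₂.1 ((mem_tilingVertices_iff h (hball hza)).1 hz)
    obtain ⟨a', ha', hb'⟩ := Set.mem_iUnion₂.1 hb'
    exact hQ.mem_nodes s5 ha ha' hb' hz' hza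

theorem disjoint_openSegment {a : PinTriangle}
    (hn : ∀ z ∈ tilingVertices T, z ∈ a.carrier → z ∈ a.nodes) {x y x' y' : ℝ}
    (hp : a.pt x y ∈ a.carrier) (hq : a.pt x' y' ∈ a.carrier)
    (h : ∀ t : ℝ, 0 < t → t < 1 → a.pt (x + t * (x' - x)) (y + t * (y' - y)) ∉ a.nodes) :
    Disjoint (openSegment ℝ (a.pt x y) (a.pt x' y')) (tilingVertices T) := by
  refine Set.disjoint_left.2 fun z hz hzT => ?_
  have hza := (convex_carrier a).openSegment_subset hp hq hz
  rw [openSegment_eq_image'] at hz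
  obtain ⟨t, ⟨t0, t1⟩, rfl⟩ := hz
  refine h t t0 t1 ?_
  convert hn _ hzT hza using 1
  simp only [pt, Complex.real_smul]
  push_cast
  ring

/-- The points `f`, `h₁`, `m` are pairwise adjacent: none of the nine nodes lies strictly between
two of them, so the three sides of the middle tile are edges. -/
theorem three_le_chromaticNumber (hT : IsPinwheelTiling T) :
    3 ≤ (tilingGraph T).chromaticNumber := by
  obtain ⟨a, ha, hsub, hn⟩ := hT.exists_level_one
  have s5 : 0 < √5 := by positivity
  have e := @pt_inj a _ s5 ha
  have hb : (⟨a.f, a.h₁, a.m⟩ : PinTriangle) ∈ T := hsub (by simp [subdivide])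
  have vert : ∀ z ∈ corners ⟨a.f, a.h₁, a.m⟩, z ∈ tilingVertices T := fun z hz =>
    Set.mem_biUnion hb hz
  have car : ∀ z ∈ corners ⟨a.f, a.h₁, a.m⟩, z ∈ a.carrier := fun z hz =>
    carrier_subset_of_mem_subdivide (by simp [subdivide]) (corner_mem_carrier hz)
  have cf := car a.f (by simp [corners])
  have ch := car a.h₁ (by simp [corners])
  have cm := car a.m (by simp [corners])
  have nodes_iff : ∀ x y : ℝ, a.pt x y ∈ a.nodes ↔ (x = 0 ∧ y = 0) ∨ (x = 1 ∧ y = 0) ∨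
      (x = 0 ∧ y = 1) ∨ (x = 4 / 5 ∧ y = 1 / 5) ∨ (x = 2 / 5 ∧ y = 3 / 5) ∨ (x = 0 ∧ y = 1 / 2) ∨
      (x = 2 / 5 ∧ y = 1 / 10) ∨ (x = 3 / 5 ∧ y = 2 / 5) ∨ (x = 1 / 5 ∧ y = 4 / 5) := by
    intro x y
    have g₁ : (3 * a.s + 2 * a.l) / 5 = a.pt (3 / 5) (2 / 5) := by simp [pt]; ring
    have g₂ : (a.s + 4 * a.l) / 5 = a.pt (1 / 5) (4 / 5) := by simp [pt]; ring
    simp only [nodes, g₁, g₂, Set.mem_insert_iff, Set.mem_singleton_iff, h₁_eq_pt, h₂_eq_pt,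
      m_eq_pt, f_eq_pt]
    rw [r_eq_pt, s_eq_pt, l_eq_pt]
    simp only [e]
  have dfh : Disjoint (openSegment ℝ a.f a.h₁) (tilingVertices T) := by
    rw [f_eq_pt, h₁_eq_pt] at *
    refine disjoint_openSegment hn cf ch fun t t0 t1 ht => ?_
    rw [nodes_iff] at ht
    rcases ht with h | h | h | h | h | h | h | h | h <;> linarith [h.1, h.2]
  have dfm : Disjoint (openSegment ℝ a.f a.m) (tilingVertices T) := by
    rw [f_eq_pt, m_eq_pt] at *
    refine disjoint_openSegment hn cf cm fun t t0 t1 ht => ?_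
    rw [nodes_iff] at ht
    rcases ht with h | h | h | h | h | h | h | h | h <;> linarith [h.1, h.2]
  have dhm : Disjoint (openSegment ℝ a.h₁ a.m) (tilingVertices T) := by
    rw [h₁_eq_pt, m_eq_pt] at *
    refine disjoint_openSegment hn ch cm fun t t0 t1 ht => ?_
    rw [nodes_iff] at ht
    rcases ht with h | h | h | h | h | h | h | h | h <;> linarith [h.1, h.2]
  have nfh : a.f ≠ a.h₁ := by rw [f_eq_pt, h₁_eq_pt, ne_eq, e]; norm_num
  have nfm : a.f ≠ a.m := by rw [f_eq_pt, m_eq_pt, ne_eq, e]; norm_num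
  have nhm : a.h₁ ≠ a.m := by rw [h₁_eq_pt, m_eq_pt, ne_eq, e]; norm_num
  let F : tilingVertices T := ⟨a.f, vert _ (by simp [corners])⟩
  let H : tilingVertices T := ⟨a.h₁, vert _ (by simp [corners])⟩
  let M : tilingVertices T := ⟨a.m, vert _ (by simp [corners])⟩
  have aFH : (tilingGraph T).Adj F H := ⟨fun h => nfh (congrArg Subtype.val h),
    ⟨_, hb, _, .inl rfl, left_mem_segment ℝ _ _, right_mem_segment ℝ _ _⟩, dfh⟩
  have aFM : (tilingGraph T).Adj F M := ⟨fun h => nfm (congrArg Subtype.val h),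
    ⟨_, hb, _, .inr (.inl rfl), left_mem_segment ℝ _ _, right_mem_segment ℝ _ _⟩, dfm⟩
  have aHM : (tilingGraph T).Adj H M := ⟨fun h => nhm (congrArg Subtype.val h),
    ⟨_, hb, _, .inr (.inr rfl), left_mem_segment ℝ _ _, right_mem_segment ℝ _ _⟩, dhm⟩
  refine SimpleGraph.le_chromaticNumber_of_pairwise_adj (n := 3) (ι := Fin 3) (by simp) ![F, H, M] ?_
  intro i j hij
  fin_cases i <;> fin_cases j <;>
    first
    | exact absurd rfl hij
    | exact aFH
    | exact aFM
    | exact aHM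
    | exact aFH.symm
    | exact aFM.symm
    | exact aHM.symm

end IsPinwheelTiling

theorem theorem6p2 (T : Set PinTriangle) (hT : IsPinwheelTiling T) :
    (tilingGraph T).chromaticNumber = 3 :=
  le_antisymm hT.colorable.chromaticNumber_le hT.three_le_chromaticNumber
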